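/- Let $H$ be a real Hilbert space and let $A:D(A)\subset H\to H$ be a strictly positive self-adjoint operator with compact inverse. Let $\mathcal C\in\mathcal L(H)$, and let $\rho:[0,\infty)\to[0,\infty)$ be continuous with $\rho(s)>0$ for $s>0$, such that for some constants $\gamma,c_0,c_1>0$ $$c_0s^\gamma\le\rho(s)\le c_1s^\gamma,\qquad s\in[0,1].$$ Consider $$u_{tt}+Au+\rho(\|\mathcal C u_t\|_H^2)\,u_t=0\quad (t\ge 0),\qquad E(t)=\tfrac12\bigl(\|u_t(t)\|_H^2+\|A^{1/2}u(t)\|_H^2\bigr).\tag{1}$$ A strong solution is one with $u\in C([0,\infty);D(A))\cap C^1([0,\infty);D(A^{1/2}))\cap C^2([0,\infty);H)$ satisfying the equation pointwise. A finite energy solution is a $u\in C([0,\infty);D(A^{1/2}))\cap C^1([0,\infty);H)$ such that, for all $\varphi\in D(A^{1/2})$ and all $t\ge0$, $$\tfrac{d}{dt}\langle u_t,\varphi\rangle+\langle A^{1/2}u,A^{1/2}\varphi\rangle+\rho(\|\mathcal C u_t\|_H^2)\langle u_t,\varphi\rangle=0 .$$ Assume that at least one of the following observability inequalities holds: (a)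 there are $T,c>0$ such that every strong solution $w$ of the linear conservative problem $w_{tt}+Aw=0$ satisfies $\int_0^T\|\mathcal C w_t(t)\|_H^2\,dt\ge c\cdot\tfrac12\bigl(\|w_t(0)\|_H^2+\|A^{1/2}w(0)\|_H^2\bigr)$; (b) there are $T,c>0$ such that every strong solution $u$ of (1) satisfies $\int_t^{t+T}\|\mathcal C u_t(\tau)\|_H^2\,d\tau\ge c\int_t^{t+T}E(\tau)\,d\tau$ for all $t\ge0$. Then for every $M$ there is a constant $C>0$ such that every finite energy solution of (1), with arbitrary initial data $(u(0),u_t(0))\in D(A^{1/2})\times H$ satisfying $E(0)\le M$, obeys $$E(t)\le \frac{C}{(1+t)^{1/\gamma}},\qquad t\ge0.$$ -/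

import Mathlib

noncomputable section

namespace DampedWave

variable {H : Type*} [NormedAddCommGroup H] [InnerProductSpace ℝ H] [CompleteSpace H]

/-- A strictly positive self-adjoint (densely defined, in general unbounded) operator on the real
Hilbert space `H` which has a compact inverse. -/
structure IsPositiveCompactInverse (A : H →ₗ.[ℝ] H) : Prop where
  selfAdjoint : IsSelfAdjoint A
  pos : ∀ x : A.domain, (x : H) ≠ 0 → 0 < inner ℝ (A x) (x : H)
  compactInverse : ∃ K : H →L[ℝ] H, IsCompactOperator K ∧
    ∀ x y : H, (x, y) ∈ A.graph ↔ K y = x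

/-- The eigenspace `{x ∈ D(A) : A x = μ x}`. -/
def eigenspace (A : H →ₗ.[ℝ] H) (μ : ℝ) : Submodule ℝ H where
  carrier := {x | (x, μ • x) ∈ A.graph}
  add_mem' {x y} hx hy := by
    have h := A.graph.add_mem hx hy
    simpa [smul_add] using h
  zero_mem' := by
    change ((0 : H), μ • (0 : H)) ∈ A.graph
    rw [smul_zero]
    exact A.graph.zero_mem
  smul_mem' c x hx := by
    have h := A.graph.smul_mem c hx
    simpa [smul_comm c μ x] using h

/-- The orthogonal projection of `H` onto the eigenspace of `A` at `μ`. (Eigenspaces of a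
self-adjoint operator are closed, so for such `A` taking the closure changes nothing.) -/
def eigenProj (A : H →ₗ.[ℝ] H) (μ : ℝ) : H →L[ℝ] H :=
  (eigenspace A μ).topologicalClosure.starProjection

/-- The square root `A^{1/2}` of a positive self-adjoint operator with compact inverse, through
its spectral decomposition `A = ∑_μ μ P_μ`, where `P_μ` is the orthogonal projection onto the
eigenspace at `μ` (which is zero unless `μ` is an eigenvalue):
`A^{1/2} x = ∑_μ √μ P_μ x`, with domain the set of all `x` for which the series converges.
By orthogonality of the eigenspaces, it converges if and only if `∑_μ μ ‖P_μ x‖² < ∞`. -/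
def sqrtOp (A : H →ₗ.[ℝ] H) : H →ₗ.[ℝ] H where
  domain :=
    { carrier := {x | Summable fun μ : ℝ => √μ • eigenProj A μ x}
      add_mem' := by
        intro x y hx hy
        have h := Summable.add hx hy
        simpa [smul_add] using h
      zero_mem' := by simp [summable_zero]
      smul_mem' := by
        intro c x hx
        have h := Summable.const_smul c hx
        simpa [smul_comm c] using h }
  toFun :=
    { toFun := fun x => ∑' μ : ℝ, √μ • eigenProj A μ (x : H)
      map_add' := by
        intro x y
        have h := Summable.tsum_add x.2 y.2
        simpa [smul_add] using h
      map_smul' := by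
        intro c x
        have h := Summable.tsum_const_smul c x.2
        simpa [smul_comm c] using h }

open Classical in
/-- The value `T x` of a partially defined operator; it is used only at points `x ∈ D(T)`. -/
def opVal (T : H →ₗ.[ℝ] H) (x : H) : H :=
  if h : x ∈ T.domain then T ⟨x, h⟩ else 0

/-- The energy `½ (‖v‖² + ‖A^{1/2} u‖²)` of a state `(u, v) ∈ D(A^{1/2}) × H`. -/
def energy (A : H →ₗ.[ℝ] H) (u v : H) : ℝ :=
  (1 / 2) * (‖v‖ ^ 2 + ‖opVal (sqrtOp A) u‖ ^ 2)

/-- `u` is a strong (classical) solution on `[0, ∞)`, with velocity `v = u_t`, of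
`u_tt + A u + ρ(‖C u_t‖²) u_t = 0`. -/
structure IsStrongSolution (A : H →ₗ.[ℝ] H) (C : H →L[ℝ] H) (ρ : ℝ → ℝ) (u v : ℝ → H) :
    Prop where
  mem_domain : ∀ t, 0 ≤ t → u t ∈ A.domain
  mem_sqrt_domain : ∀ t, 0 ≤ t → u t ∈ (sqrtOp A).domain
  velocity_mem_sqrt_domain : ∀ t, 0 ≤ t → v t ∈ (sqrtOp A).domain
  continuousOn_op : ContinuousOn (fun t => opVal A (u t)) (Set.Ici 0)
  continuousOn_sqrt : ContinuousOn (fun t => opVal (sqrtOp A) (u t)) (Set.Ici 0)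
  continuousOn_sqrt_velocity : ContinuousOn (fun t => opVal (sqrtOp A) (v t)) (Set.Ici 0)
  velocity : ∀ t, 0 ≤ t → HasDerivWithinAt u (v t) (Set.Ici 0) t
  equation : ∀ t, 0 ≤ t →
    HasDerivWithinAt v (-opVal A (u t) - ρ (‖C (v t)‖ ^ 2) • v t) (Set.Ici 0) t

/-- `u` is a finite energy (weak) solution on `[0, ∞)`, with velocity `v = u_t`, of
`u_tt + A u + ρ(‖C u_t‖²) u_t = 0`: `u ∈ C([0, ∞); D(A^{1/2})) ∩ C¹([0, ∞); H)`, and the equation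
holds when tested against every `φ ∈ D(A^{1/2})`. The initial datum is
`(u 0, v 0) ∈ D(A^{1/2}) × H`. -/
structure IsWeakSolution (A : H →ₗ.[ℝ] H) (C : H →L[ℝ] H) (ρ : ℝ → ℝ) (u v : ℝ → H) :
    Prop where
  mem_sqrt_domain : ∀ t, 0 ≤ t → u t ∈ (sqrtOp A).domain
  continuousOn_sqrt : ContinuousOn (fun t => opVal (sqrtOp A) (u t)) (Set.Ici 0)
  velocity : ∀ t, 0 ≤ t → HasDerivWithinAt u (v t) (Set.Ici 0) t
  continuousOn_velocity : ContinuousOn v (Set.Ici 0)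
  equation : ∀ φ ∈ (sqrtOp A).domain, ∀ t, 0 ≤ t →
    HasDerivWithinAt (fun s => inner ℝ (v s) φ)
      (-inner ℝ (opVal (sqrtOp A) (u t)) (opVal (sqrtOp A) φ)
        - ρ (‖C (v t)‖ ^ 2) * inner ℝ (v t) φ) (Set.Ici 0) t

/-- Observability through `C` of the linear conservative problem `w_tt + A w = 0`:
`∫_0^T ‖C w_t‖² ≥ c E(0)` for its strong solutions. -/
def LinearlyObservable (A : H →ₗ.[ℝ] H) (C : H →L[ℝ] H) : Prop :=
  ∃ T > 0, ∃ c > 0, ∀ w z : ℝ → H, IsStrongSolution A C (fun _ => 0) w z →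
    c * energy A (w 0) (z 0) ≤ ∫ t in (0 : ℝ)..T, ‖C (z t)‖ ^ 2

/-- Integral observability in velocity along the damped flow:
`∫_t^{t+T} ‖C u_t‖² ≥ c ∫_t^{t+T} E` for all `t ≥ 0` and all strong solutions of
`u_tt + A u + ρ(‖C u_t‖²) u_t = 0`. -/
def IntegrallyObservable (A : H →ₗ.[ℝ] H) (C : H →L[ℝ] H) (ρ : ℝ → ℝ) : Prop :=
  ∃ T > 0, ∃ c > 0, ∀ u v : ℝ → H, IsStrongSolution A C ρ u v → ∀ t, 0 ≤ t →
    c * ∫ τ in t..(t + T), energy A (u τ) (v τ) ≤ ∫ τ in t..(t + T), ‖C (v τ)‖ ^ 2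

end DampedWave

end

/-! The damping acts on u_t through one scalar a(t) = ρ(‖C u_t‖²). Hence, in an eigenbasis of A, any
finite set of modes of a finite energy solution solves exactly the linear system with that same a(t)
(`IsWeakSolution.isModeSolution`). All estimates are made there and passed to the limit; finite
energy solutions are never approximated by strong ones.

On modes, a damped solution is compared with the conservative one having the same data. As a² ≤ L a,
a Gronwall argument bounds the energy of the difference by the dissipated energy
(`modeEnergy_sub_le`). Observability of the conservative flow then gives c E(s) ≤ 2∫‖C u_t‖² +
const·Δ over [s, s+T], where Δ = E(s) - E(s+T) = ∫ a ‖u_t‖². Since ρ(q) ≥ κ q^γ on bounded sets, ‖C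
u_t‖² ≤ η + η^(-γ) (‖C‖²/κ) a ‖u_t‖². Taking η proportional to E(s) yields k E(s)^(1+γ) ≤ Δ, and
Nakao's lemma gives the rate.

Hypothesis (b) reduces to (a) on modes: for data scaled by a small ε the damping is small, because
ρ(0) = 0, and after division by ε the solution is close to the conservative one. This needs strong
solutions with data in a finite span while ρ is merely continuous, hence Peano's theorem. -/

set_option linter.unusedSectionVars false

namespace DampedWave

open Filter Topology

universe u

/-! ### Peano's theorem by Tonelli's delayed equations. -/

/-- **Peano's theorem**, for a bounded continuous autonomous field on a finite-dimensional space. -/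
theorem exists_forall_hasDerivWithinAt_of_bounded {E : Type*} [NormedAddCommGroup E]
    [NormedSpace ℝ E] [FiniteDimensional ℝ E] {F : E → E} (hF : Continuous F) {B : ℝ}
    (hB : ∀ x, ‖F x‖ ≤ B) (x₀ : E) :
    ∃ x : ℝ → E, x 0 = x₀ ∧ ∀ t, 0 ≤ t → HasDerivWithinAt x (F (x t)) (Set.Ici 0) t := by
  have hB0 : 0 ≤ B := (norm_nonneg _).trans (hB x₀)
  -- iterates of the Tonelli operator with delay `h`
  let Φ : ℝ → (ℝ → E) → ℝ → E := fun h x t => x₀ + ∫ s in (0 : ℝ)..max t 0, F (x (s - h))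
  let y : ℝ → ℕ → ℝ → E := fun h k => (Φ h)^[k] (fun _ => x₀)
  have hysucc : ∀ h k t, y h (k + 1) t = x₀ + ∫ s in (0 : ℝ)..max t 0, F (y h k (s - h)) := by
    intro h k t
    simp only [y, Function.iterate_succ_apply', Φ]
  have hcont : ∀ h k, Continuous (y h k) := by
    intro h k
    induction k with
    | zero => exact continuous_const
    | succ k ih =>
      have : y h (k + 1) = fun t => x₀ + ∫ s in (0 : ℝ)..max t 0, F (y h k (s - h)) :=
        funext (hysucc h k)
      rw [this]
      have h1 : Continuous fun t => ∫ s in (0 : ℝ)..t, F (y h k (s - h)) :=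
        intervalIntegral.continuous_primitive (fun a b =>
          (by fun_prop : Continuous fun s => F (y h k (s - h))).intervalIntegrable a b) 0
      exact continuous_const.add (h1.comp (by fun_prop : Continuous fun t : ℝ => max t 0))
  have hint : ∀ h k a b,
      IntervalIntegrable (fun s => F (y h k (s - h))) MeasureTheory.volume a b := by
    intro h k a b
    have := hcont h k
    exact (by fun_prop : Continuous fun s => F (y h k (s - h))).intervalIntegrable a b
  have hlip : ∀ h k s t, ‖y h k t - y h k s‖ ≤ B * |t - s| := by
    intro h k s t
    cases k with
    | zero => simp only [y, Function.iterate_zero, id, sub_self, norm_zero]; positivity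
    | succ k =>
      rw [hysucc, hysucc, add_sub_add_left_eq_sub,
        intervalIntegral.integral_interval_sub_left (hint _ _ _ _) (hint _ _ _ _)]
      refine (intervalIntegral.norm_integral_le_of_norm_le_const fun _ _ => hB _).trans ?_
      exact mul_le_mul_of_nonneg_left (abs_max_sub_max_le_abs t s 0) hB0
  -- Because of the delay, values up to (k+1)h depend only on values up to kh, so each iteration
  -- settles one more interval of length h.
  have hstab : ∀ h : ℝ, 0 < h → ∀ k : ℕ, ∀ t : ℝ, t ≤ k * h → y h (k + 1) t = y h k t := by
    intro h hh k
    induction k with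
    | zero =>
      intro t ht
      rw [hysucc, max_eq_right (by simpa using ht)]
      simp [y]
    | succ k ih =>
      intro t ht
      rw [hysucc, hysucc]
      congr 1
      refine intervalIntegral.integral_congr fun s hs => ?_
      rw [Set.uIcc_of_le (le_max_right _ _)] at hs
      have h2 : s ≤ (k + 1 : ℕ) * h := hs.2.trans (max_le ht (by positivity))
      push_cast at h2
      simp only [ih (s - h) (by linarith)]
  -- (n+1)² iterations with delay 1/(n+1) settle the solution up to time n+1.
  let z : ℕ → ℝ → E := fun n => y (1 / (n + 1)) ((n + 1) * (n + 1))
  have hz : ∀ n : ℕ, ∀ t : ℝ, t ≤ n + 1 →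
      z n t = x₀ + ∫ s in (0 : ℝ)..max t 0, F (z n (s - 1 / (n + 1))) := by
    intro n t ht
    rw [← hysucc]
    refine (hstab _ (by positivity) _ _ ?_).symm
    have hn : (n : ℝ) + 1 ≠ 0 := by positivity
    push_cast
    field_simp
    exact ht
  have hz0 : ∀ n, z n 0 = x₀ := by
    intro n
    rw [hz n 0 (by positivity)]
    simp
  have hzlip : ∀ n s t, ‖z n t - z n s‖ ≤ B * |t - s| := fun n => hlip _ _
  -- A pointwise ultrafilter limit replaces the Arzelà–Ascoli subsequence; the common Lipschitz
  -- bound keeps values in compact balls.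
  let l : Filter ℕ := (hyperfilter ℕ : Filter ℕ)
  have hl : l ≤ atTop := by rw [← Nat.cofinite_eq_atTop]; exact hyperfilter_le_cofinite
  have hlim : ∀ t, ∃ p, Tendsto (fun n => z n t) l (𝓝 p) := by
    intro t
    have hc : IsCompact (Metric.closedBall x₀ (B * |t|)) := isCompact_closedBall _ _
    obtain ⟨p, -, hp⟩ := hc.ultrafilter_le_nhds ((hyperfilter ℕ).map (fun n => z n t)) (by
      rw [le_principal_iff, Ultrafilter.mem_coe, Ultrafilter.mem_map]
      refine univ_mem' fun n => ?_
      have := hzlip n 0 t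
      rw [hz0, sub_zero] at this
      simpa [dist_eq_norm] using this)
    exact ⟨p, hp⟩
  choose x hx using hlim
  refine ⟨x, tendsto_nhds_unique (hx 0) (by simp only [hz0]; exact tendsto_const_nhds), ?_⟩
  intro t ht
  rw [hasDerivWithinAt_iff_isLittleO, Asymptotics.isLittleO_iff]
  intro ε hε
  obtain ⟨δ, hδ, hFδ⟩ := Metric.continuous_iff.1 hF (x t) ε hε
  -- The time increment and the delay each move z n by at most δ/3; the last third is its distance
  -- to the limit.
  have hη : 0 < δ / (3 * (B + 1)) := by positivity
  filter_upwards [inter_mem_nhdsWithin _ (Metric.ball_mem_nhds t hη)] with r hr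
  obtain ⟨hr0, hrt⟩ := hr
  rw [Metric.mem_ball, Real.dist_eq] at hrt
  have hr0 : 0 ≤ r := hr0
  have hev : ∀ᶠ n : ℕ in l, ‖z n r - z n t - (r - t) • F (x t)‖ ≤ ε * ‖r - t‖ := by
    have e1 : ∀ᶠ n : ℕ in l, dist (z n t) (x t) < δ / 3 :=
      Metric.tendsto_nhds.1 (hx t) _ (by positivity)
    have e2 : ∀ᶠ n : ℕ in l, (1 : ℝ) / (n + 1) < δ / (3 * (B + 1)) :=
      hl ((tendsto_one_div_add_atTop_nhds_zero_nat (𝕜 := ℝ)).eventually_lt_const hη)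
    have e3 : ∀ᶠ n : ℕ in l, max r t ≤ (n : ℝ) :=
      hl (tendsto_natCast_atTop_atTop.eventually_ge_atTop _)
    filter_upwards [e1, e2, e3] with n h1 h2 h3
    have hi := hint (1 / ((n : ℝ) + 1)) ((n + 1) * (n + 1))
    rw [hz n r (by linarith [le_max_left r t]), hz n t (by linarith [le_max_right r t]),
      max_eq_left hr0, max_eq_left ht, add_sub_add_left_eq_sub,
      intervalIntegral.integral_interval_sub_left (hi _ _) (hi _ _),
      ← intervalIntegral.integral_const, ← intervalIntegral.integral_sub (hi _ _) (by simp)]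
    refine intervalIntegral.norm_integral_le_of_norm_le_const fun s hs => ?_
    rw [← dist_eq_norm]
    refine (hFδ _ ?_).le
    have hs' : |s - t| ≤ |r - t| :=
      Set.abs_sub_left_of_mem_uIcc (Set.uIoc_subset_uIcc hs)
    calc dist (z n (s - 1 / (n + 1))) (x t)
        ≤ dist (z n (s - 1 / (n + 1))) (z n t) + dist (z n t) (x t) := dist_triangle _ _ _
      _ < B * (δ / (3 * (B + 1)) + δ / (3 * (B + 1))) + δ / 3 := by
          refine add_lt_add_of_le_of_lt ?_ h1
          rw [dist_eq_norm]
          refine (hzlip n _ _).trans ?_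
          gcongr
          calc |s - 1 / ((n : ℝ) + 1) - t| = |(s - t) - 1 / ((n : ℝ) + 1)| := by ring_nf
            _ ≤ |s - t| + |1 / ((n : ℝ) + 1)| := abs_sub _ _
            _ ≤ _ := by
              rw [abs_of_pos (by positivity : (0 : ℝ) < 1 / ((n : ℝ) + 1))]
              linarith
      _ ≤ δ := by
          have : B * (δ / (3 * (B + 1))) ≤ δ / 3 := by
            rw [← div_div, ← mul_div_assoc, div_le_iff₀ (by positivity)]
            nlinarith
          linarith
  refine le_of_tendsto ?_ hev
  exact (((hx r).sub (hx t)).sub tendsto_const_nhds).norm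

/-! ### Spectral decomposition of A and of its square root. -/

section

variable {H : Type u} [NormedAddCommGroup H] [InnerProductSpace ℝ H]

theorem separableSpace_of_isCompactOperator_of_denseRange {K : H →L[ℝ] H}
    (hK : IsCompactOperator K) (hd : DenseRange K) : TopologicalSpace.SeparableSpace H := by
  have h1 : TopologicalSpace.IsSeparable (Set.range K) := by
    have h2 : Set.range K ⊆ ⋃ n : ℕ, K '' Metric.closedBall 0 n := by
      rintro _ ⟨x, rfl⟩
      obtain ⟨n, hn⟩ := exists_nat_ge ‖x‖
      exact Set.mem_iUnion.2 ⟨n, x, by simpa using hn, rfl⟩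
    refine TopologicalSpace.IsSeparable.mono (TopologicalSpace.IsSeparable.iUnion fun n => ?_) h2
    exact ((hK.isCompact_closure_image_closedBall (𝕜₁ := ℝ) (n : ℝ)).isSeparable).mono subset_closure
  rw [← TopologicalSpace.isSeparable_univ_iff, ← hd.closure_range]
  exact h1.closure

/-- Orthonormal vectors are √2 apart, so balls of radius 1/2 are disjoint. Countability is what
allows dominated convergence along finite sets of modes. -/
theorem countable_of_orthonormal [TopologicalSpace.SeparableSpace H] {ι : Type*} {v : ι → H}
    (hv : Orthonormal ℝ v) : Countable ι := by
  refine Pairwise.countable_of_isOpen_disjoint (s := fun i => Metric.ball (v i) (1 / 2)) ?_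
    (fun _ => Metric.isOpen_ball) fun i => ⟨v i, Metric.mem_ball_self (by norm_num)⟩
  intro i j hij
  refine Metric.ball_disjoint_ball ?_
  have h1 : ‖v i - v j‖ ^ 2 = 2 := by
    rw [norm_sub_sq_real, hv.1, hv.1, hv.2 hij]; norm_num
  rw [dist_eq_norm]
  nlinarith [norm_nonneg (v i - v j)]

theorem opVal_eq_of_mem_graph {T : H →ₗ.[ℝ] H} {x y : H} (h : (x, y) ∈ T.graph) :
    opVal T x = y := by
  obtain ⟨p, rfl, rfl⟩ := (LinearPMap.mem_graph_iff T).1 h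
  simp [opVal]

theorem mem_domain_of_mem_graph {T : H →ₗ.[ℝ] H} {x y : H} (h : (x, y) ∈ T.graph) :
    x ∈ T.domain := by
  obtain ⟨p, rfl, rfl⟩ := (LinearPMap.mem_graph_iff T).1 h
  exact p.2

theorem mem_graph_opVal {T : H →ₗ.[ℝ] H} {x : H} (h : x ∈ T.domain) :
    (x, opVal T x) ∈ T.graph := by
  rw [opVal, dif_pos h]
  exact T.mem_graph ⟨x, h⟩

variable [CompleteSpace H]

/-- A compact symmetric operator admits a Hilbert basis of eigenvectors. -/
theorem exists_hilbertBasis_eigenvectors {K : H →L[ℝ] H} (hK : IsCompactOperator K)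
    (hs : (K : H →ₗ[ℝ] H).IsSymmetric) :
    ∃ (ι : Type u) (b : HilbertBasis ι ℝ H) (ν : ι → ℝ), ∀ i, K (b i) = ν i • b i := by
  have hcl : ∀ μ : ℝ, IsClosed (Module.End.eigenspace (K : H →ₗ[ℝ] H) μ : Set H) := by
    intro μ
    have : (Module.End.eigenspace (K : H →ₗ[ℝ] H) μ : Set H) = {x | K x = μ • x} := by
      ext x; simp
    rw [this]
    exact isClosed_eq (by fun_prop) (by fun_prop)
  have hc : ∀ μ : ℝ, CompleteSpace (Module.End.eigenspace (K : H →ₗ[ℝ] H) μ) :=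
    fun μ => (hcl μ).completeSpace_coe
  -- Every real μ is used as an index; the basis is empty unless μ is an eigenvalue.
  choose w b hb using fun μ : ℝ => exists_hilbertBasis ℝ (Module.End.eigenspace (K : H →ₗ[ℝ] H) μ)
  have ho := hs.orthogonalFamily_eigenspaces.orthonormal_sigma_orthonormal
    (v_family := fun μ => (b μ : w μ → Module.End.eigenspace (K : H →ₗ[ℝ] H) μ))
    (fun μ => (b μ).orthonormal)
  refine ⟨(μ : ℝ) × w μ, HilbertBasis.mkOfOrthogonalEqBot ho ?_, fun i => i.1, ?_⟩
  · rw [eq_bot_iff,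
      ← ContinuousLinearMap.orthogonalComplement_iSup_eigenspaces_eq_bot hK hs]
    rw [← Submodule.orthogonal_closure (Submodule.span ℝ _)]
    refine Submodule.orthogonal_le (iSup_le fun μ => ?_)
    intro x hx
    have h1 := (b μ).hasSum_repr ⟨x, hx⟩
    have h2 := h1.mapL (Submodule.subtypeL _)
    refine (Submodule.isClosed_topologicalClosure _).mem_of_tendsto h2
      (Eventually.of_forall fun s => ?_)
    refine Submodule.sum_mem _ fun i _ => Submodule.le_topologicalClosure _ ?_
    simp only [map_smul]
    exact Submodule.smul_mem _ _ (Submodule.subset_span ⟨⟨μ, i⟩, rfl⟩)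
  · intro i
    rw [HilbertBasis.coe_mkOfOrthogonalEqBot]
    exact Module.End.mem_eigenspace_iff.1 (b i.1 i.2).2

/-- A Hilbert basis of eigenvectors of `A` with positive eigenvalues. -/
structure EigenBasis (A : H →ₗ.[ℝ] H) (ι : Type u) where
  basis : HilbertBasis ι ℝ H
  eigenvalue : ι → ℝ
  eigenvalue_pos : ∀ i, 0 < eigenvalue i
  mem_graph : ∀ i, (basis i, eigenvalue i • basis i) ∈ A.graph
  symm : ∀ x y x' y' : H, (x, y) ∈ A.graph → (x', y') ∈ A.graph → inner ℝ y x' = inner ℝ x y'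

theorem IsPositiveCompactInverse.inner_symm {A : H →ₗ.[ℝ] H} (hA : IsPositiveCompactInverse A)
    {x y x' y' : H} (h : (x, y) ∈ A.graph) (h' : (x', y') ∈ A.graph) :
    inner ℝ y x' = inner ℝ x y' := by
  obtain ⟨p, rfl, rfl⟩ := (LinearPMap.mem_graph_iff A).1 h
  obtain ⟨q, rfl, rfl⟩ := (LinearPMap.mem_graph_iff A).1 h'
  have hf := LinearPMap.adjoint_isFormalAdjoint (T := A) hA.selfAdjoint.dense_domain
  rw [LinearPMap.isSelfAdjoint_def.1 hA.selfAdjoint] at hf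
  exact hf p q

/-- The inverse K is compact, and symmetric because A is. Its eigenvalues are nonzero since A is
single-valued, and their inverses are eigenvalues of A. -/
theorem IsPositiveCompactInverse.exists_eigenBasis {A : H →ₗ.[ℝ] H}
    (hA : IsPositiveCompactInverse A) :
    ∃ ι : Type u, Countable ι ∧ Nonempty (EigenBasis A ι) := by
  obtain ⟨K, hK, hKA⟩ := hA.compactInverse
  have hgr : ∀ y, (K y, y) ∈ A.graph := fun y => (hKA _ _).2 rfl
  have hs : (K : H →ₗ[ℝ] H).IsSymmetric := fun x y =>
    (hA.inner_symm (hgr x) (hgr y)).symm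
  obtain ⟨ι, b, ν, hb⟩ := exists_hilbertBasis_eigenvectors hK hs
  have hrange : (A.domain : Set H) ⊆ Set.range K := by
    intro x hx
    exact ⟨A ⟨x, hx⟩, (hKA _ _).1 (A.mem_graph ⟨x, hx⟩)⟩
  have : TopologicalSpace.SeparableSpace H :=
    separableSpace_of_isCompactOperator_of_denseRange hK
      (hA.selfAdjoint.dense_domain.mono hrange)
  have hne : ∀ i, b i ≠ 0 := fun i => b.orthonormal.ne_zero i
  have hν : ∀ i, ν i ≠ 0 := by
    intro i h0
    have h1 := hgr (b i)
    rw [hb, h0, zero_smul] at h1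
    exact hne i (A.graph_fst_eq_zero_snd h1 rfl)
  have hg : ∀ i, (b i, (ν i)⁻¹ • b i) ∈ A.graph := by
    intro i
    rw [hKA, map_smul, hb, smul_smul, inv_mul_cancel₀ (hν i), one_smul]
  refine ⟨ι, countable_of_orthonormal b.orthonormal,
    ⟨⟨b, fun i => (ν i)⁻¹, fun i => ?_, hg, fun x y x' y' h h' => hA.inner_symm h h'⟩⟩⟩
  obtain ⟨p, hp, hp'⟩ := (LinearPMap.mem_graph_iff A).1 (hg i)
  simp only at hp hp'
  have h1 := hA.pos p (by rw [hp]; exact hne i)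
  rw [hp', hp, real_inner_smul_left, real_inner_self_eq_norm_sq, b.orthonormal.1] at h1
  simpa using h1

namespace EigenBasis

variable {A : H →ₗ.[ℝ] H} {ι : Type u} (B : EigenBasis A ι)

/-- The coordinate of a vector along a basis vector. -/
noncomputable def coord (i : ι) (x : H) : ℝ := inner ℝ x (B.basis i)

theorem eigenProj_basis [DecidableEq ℝ] (μ : ℝ) (i : ι) :
    eigenProj A μ (B.basis i) = if μ = B.eigenvalue i then B.basis i else 0 := by
  split_ifs with h
  · subst h
    exact Submodule.starProjection_eq_self_iff.2
      (Submodule.le_topologicalClosure _ (B.mem_graph i))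
  · refine (Submodule.starProjection_apply_eq_zero_iff _).2 ?_
    rw [Submodule.orthogonal_closure, Submodule.mem_orthogonal]
    intro x hx
    have h1 := B.symm x (μ • x) _ _ hx (B.mem_graph i)
    rw [real_inner_smul_left, real_inner_smul_right] at h1
    have h2 : (μ - B.eigenvalue i) * inner ℝ x (B.basis i) = 0 := by linear_combination h1
    exact (mul_eq_zero.1 h2).resolve_left (sub_ne_zero.2 h)

theorem basis_mem_sqrtOp_graph (i : ι) :
    (B.basis i, √(B.eigenvalue i) • B.basis i) ∈ (sqrtOp A).graph := by
  classical
  have h : HasSum (fun μ : ℝ => √μ • eigenProj A μ (B.basis i))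
      (√(B.eigenvalue i) • B.basis i) := by
    have := hasSum_single (f := fun μ : ℝ => √μ • eigenProj A μ (B.basis i)) (B.eigenvalue i)
      (by intro μ hμ; simp [B.eigenProj_basis, hμ])
    simpa [B.eigenProj_basis] using this
  exact (LinearPMap.mem_graph_iff _).2 ⟨⟨B.basis i, h.summable⟩, rfl, h.tsum_eq⟩

/-- Pairing the defining series with a basis vector, and moving the symmetric projection onto it,
kills every term except the one at its eigenvalue. -/
theorem coord_sqrtOp {x y : H} (h : (x, y) ∈ (sqrtOp A).graph) (i : ι) :
    B.coord i y = √(B.eigenvalue i) * B.coord i x := by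
  classical
  obtain ⟨p, rfl, rfl⟩ := (LinearPMap.mem_graph_iff _).1 h
  have h1 : HasSum (fun μ : ℝ => √μ • eigenProj A μ (p : H)) (sqrtOp A p) := p.2.hasSum
  have h2 := h1.mapL (innerSL ℝ (B.basis i))
  have h3 : ∀ μ : ℝ, innerSL ℝ (B.basis i) (√μ • eigenProj A μ (p : H)) =
      if μ = B.eigenvalue i then √(B.eigenvalue i) * B.coord i p else 0 := by
    intro μ
    rw [innerSL_apply_apply, real_inner_smul_right, real_inner_comm, eigenProj,
      Submodule.inner_starProjection_left_eq_right, ← eigenProj, B.eigenProj_basis]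
    split_ifs with h
    · rw [h, coord]
    · simp
  simp only [h3] at h2
  have h4 := h2.unique (hasSum_ite_eq (B.eigenvalue i) _)
  rw [coord, real_inner_comm]
  simpa using h4

theorem hasSum_coord_sq (x : H) : HasSum (fun i => B.coord i x ^ 2) (‖x‖ ^ 2) := by
  have h := B.basis.hasSum_inner_mul_inner x x
  rw [real_inner_self_eq_norm_sq] at h
  have h1 : ∀ i, B.coord i x ^ 2 = inner ℝ x (B.basis i) * inner ℝ (B.basis i) x := by
    intro i
    rw [coord, real_inner_comm x, sq]
  simpa only [h1] using h

theorem hasSum_coord_smul (x : H) : HasSum (fun i => B.coord i x • B.basis i) x := by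
  have h := B.basis.hasSum_repr x
  simp only [HilbertBasis.repr_apply_apply, real_inner_comm x] at h
  exact h

theorem hasSum_energy {x : H} (hx : x ∈ (sqrtOp A).domain) (v : H) :
    HasSum (fun i => (1 / 2) * (B.coord i v ^ 2 + B.eigenvalue i * B.coord i x ^ 2))
      (energy A x v) := by
  have h1 := ((B.hasSum_coord_sq v).add
    (B.hasSum_coord_sq (opVal (sqrtOp A) x))).mul_left (1 / 2)
  simp only [B.coord_sqrtOp (mem_graph_opVal hx), mul_pow,
    Real.sq_sqrt (B.eigenvalue_pos _).le] at h1
  exact h1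

end EigenBasis

end

/-! ### Finite systems of modes and comparison with the conservative flow. -/

section

/-- Global solutions of a finite system of oscillators with a common continuous nonnegative
damping coefficient. -/
theorem exists_damped_oscillators {κ : Type*} [Fintype κ] {lam : κ → ℝ} (hlam : ∀ i, 0 < lam i)
    {g : (κ → ℝ) → ℝ} (hg : Continuous g) (hg0 : ∀ q, 0 ≤ g q) (p₀ q₀ : κ → ℝ) :
    ∃ p q : ℝ → κ → ℝ, p 0 = p₀ ∧ q 0 = q₀ ∧ ∀ t, 0 ≤ t → ∀ i,
      HasDerivWithinAt (fun s => p s i) (q t i) (Set.Ici 0) t ∧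
      HasDerivWithinAt (fun s => q s i) (-(lam i * p t i) - g (q t) * q t i) (Set.Ici 0) t := by
  let N : (κ → ℝ) × (κ → ℝ) → ℝ := fun x => ∑ i, (x.2 i ^ 2 + lam i * x.1 i ^ 2)
  have hterm : ∀ (x : (κ → ℝ) × (κ → ℝ)) i, 0 ≤ x.2 i ^ 2 + lam i * x.1 i ^ 2 := fun x i => by
    have := (hlam i).le
    positivity
  set E₀ := N (p₀, q₀) with hE₀
  let R : ℝ := √E₀ + ∑ i, √(E₀ / lam i)
  have hR : ∀ x, N x ≤ E₀ → ‖x‖ ≤ R := by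
    intro x hx
    have h1 : ∀ i, x.2 i ^ 2 + lam i * x.1 i ^ 2 ≤ E₀ := fun i =>
      (Finset.single_le_sum (fun j _ => hterm x j) (Finset.mem_univ i)).trans hx
    have h2 : 0 ≤ ∑ i, √(E₀ / lam i) := by positivity
    refine max_le ?_ ?_
    · refine (pi_norm_le_iff_of_nonneg (by positivity)).2 fun i => ?_
      have h3 : |x.1 i| ≤ √(E₀ / lam i) := by
        refine Real.abs_le_sqrt ?_
        rw [le_div_iff₀ (hlam i)]
        nlinarith [h1 i, sq_nonneg (x.2 i)]
      have h4 := Finset.single_le_sum (f := fun i => √(E₀ / lam i))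
        (fun j _ => Real.sqrt_nonneg _) (Finset.mem_univ i)
      exact (h3.trans h4).trans (le_add_of_nonneg_left (Real.sqrt_nonneg _))
    · refine (pi_norm_le_iff_of_nonneg (by positivity)).2 fun i => ?_
      have h3 : |x.2 i| ≤ √E₀ := by
        refine Real.abs_le_sqrt ?_
        nlinarith [h1 i, mul_nonneg (hlam i).le (sq_nonneg (x.1 i))]
      exact h3.trans (le_add_of_nonneg_right h2)
  let F : (κ → ℝ) × (κ → ℝ) → (κ → ℝ) × (κ → ℝ) :=
    fun x => (x.2, fun i => -(lam i * x.1 i) - g x.2 * x.2 i)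
  -- The cutoff makes the field bounded. It multiplies the whole field, so the oscillator terms
  -- still cancel in the derivative of N, and the orbit stays in the ball of radius R, where χ = 1.
  let χ : (κ → ℝ) × (κ → ℝ) → ℝ := fun x => max 0 (min 1 (R + 1 - ‖x‖))
  have hF : Continuous F := by fun_prop
  have hχ : Continuous χ := by fun_prop
  have hχ0 : ∀ x, 0 ≤ χ x := fun x => le_max_left _ _
  have hsupp : HasCompactSupport (fun x => χ x • F x) := by
    refine HasCompactSupport.intro (isCompact_closedBall 0 (R + 1)) fun x hx => ?_
    have h1 : R + 1 < ‖x‖ := by simpa using hx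
    have h2 : χ x = 0 := max_eq_left ((min_le_right _ _).trans (by linarith))
    simp [h2]
  obtain ⟨b, hb⟩ := (hχ.smul hF).bounded_above_of_compact_support hsupp
  obtain ⟨x, hx0, hx⟩ := exists_forall_hasDerivWithinAt_of_bounded (hχ.smul hF) hb (p₀, q₀)
  have hx1 : ∀ t, 0 ≤ t → ∀ i,
      HasDerivWithinAt (fun s => (x s).1 i) (χ (x t) * (x t).2 i) (Set.Ici 0) t := by
    intro t ht i
    have h1 := (hx t ht).fst
    exact (hasDerivWithinAt_pi.1 h1) i
  have hx2 : ∀ t, 0 ≤ t → ∀ i, HasDerivWithinAt (fun s => (x s).2 i)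
      (χ (x t) * (-(lam i * (x t).1 i) - g (x t).2 * (x t).2 i)) (Set.Ici 0) t := by
    intro t ht i
    have h1 := (hx t ht).snd
    exact (hasDerivWithinAt_pi.1 h1) i
  have hN : ∀ t, 0 ≤ t → HasDerivWithinAt (fun s => N (x s))
      (-(2 * (χ (x t) * (g (x t).2 * ∑ i, (x t).2 i ^ 2)))) (Set.Ici 0) t := by
    intro t ht
    have h1 := HasDerivWithinAt.fun_sum (u := Finset.univ) fun i _ =>
      ((hx2 t ht i).pow 2).add (((hx1 t ht i).pow 2).const_mul (lam i))
    refine h1.congr_deriv ?_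
    rw [Finset.mul_sum, Finset.mul_sum, Finset.mul_sum, ← Finset.sum_neg_distrib]
    refine Finset.sum_congr rfl fun i _ => ?_
    simp only [Nat.add_one_sub_one, pow_one]
    push_cast
    ring
  have hanti : AntitoneOn (fun s => N (x s)) (Set.Ici 0) := by
    refine antitoneOn_of_hasDerivWithinAt_nonpos (convex_Ici 0)
      (fun t ht => (hN t ht).continuousWithinAt)
      (fun t ht => (hN t (interior_subset ht)).mono interior_subset) fun t ht => ?_
    have := hg0 (x t).2
    have := hχ0 (x t)
    have : 0 ≤ ∑ i, (x t).2 i ^ 2 := by positivity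
    have : 0 ≤ 2 * (χ (x t) * (g (x t).2 * ∑ i, (x t).2 i ^ 2)) := by positivity
    linarith
  have hχ1 : ∀ t, 0 ≤ t → χ (x t) = 1 := by
    intro t ht
    have h1 : N (x t) ≤ E₀ := by
      have := hanti Set.self_mem_Ici (Set.mem_Ici.2 ht) ht
      simpa only [hx0] using this
    have h2 := hR _ h1
    simp only [χ]
    rw [min_eq_left (by linarith), max_eq_right zero_le_one]
  refine ⟨fun t => (x t).1, fun t => (x t).2, by simp [hx0], by simp [hx0], fun t ht i => ⟨?_, ?_⟩⟩
  · simpa only [hχ1 t ht, one_mul] using hx1 t ht i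
  · simpa only [hχ1 t ht, one_mul] using hx2 t ht i

variable {H : Type u} [NormedAddCommGroup H] [InnerProductSpace ℝ H] [CompleteSpace H]

namespace EigenBasis

variable {A : H →ₗ.[ℝ] H} {ι : Type u} (B : EigenBasis A ι)

/-- The finite linear combination of basis vectors with coefficients `q`. -/
noncomputable def modeSum (S : Finset ι) (q : ι → ℝ) : H := ∑ i ∈ S, q i • B.basis i

/-- The energy carried by the modes in `S`. -/
noncomputable def modeEnergy (S : Finset ι) (p q : ι → ℝ) : ℝ :=
  (1 / 2) * ∑ i ∈ S, (q i ^ 2 + B.eigenvalue i * p i ^ 2)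

/-- The modes in `S` of a solution of `u_tt + A u + a(t) u_t = 0`. -/
def IsModeSolution (S : Finset ι) (a : ℝ → ℝ) (p q : ℝ → ι → ℝ) : Prop :=
  ∀ t, 0 ≤ t → ∀ i ∈ S, HasDerivWithinAt (fun s => p s i) (q t i) (Set.Ici 0) t ∧
    HasDerivWithinAt (fun s => q s i) (-(B.eigenvalue i * p t i) - a t * q t i) (Set.Ici 0) t

theorem norm_modeSum_sq (S : Finset ι) (q : ι → ℝ) :
    ‖B.modeSum S q‖ ^ 2 = ∑ i ∈ S, q i ^ 2 := by
  rw [← real_inner_self_eq_norm_sq, modeSum, B.basis.orthonormal.inner_sum]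
  simp [sq]

theorem modeSum_sub (S : Finset ι) (q q' : ι → ℝ) :
    B.modeSum S (q - q') = B.modeSum S q - B.modeSum S q' := by
  simp [modeSum, sub_smul]

theorem modeSum_smul (S : Finset ι) (r : ℝ) (q : ι → ℝ) :
    B.modeSum S (r • q) = r • B.modeSum S q := by
  simp [modeSum, Finset.smul_sum, smul_smul]

theorem modeEnergy_smul (S : Finset ι) (r : ℝ) (p q : ι → ℝ) :
    B.modeEnergy S (r • p) (r • q) = r ^ 2 * B.modeEnergy S p q := by
  simp only [modeEnergy, Pi.smul_apply, smul_eq_mul, Finset.mul_sum]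
  exact Finset.sum_congr rfl fun i _ => by ring

theorem modeEnergy_nonneg (S : Finset ι) (p q : ι → ℝ) : 0 ≤ B.modeEnergy S p q := by
  refine mul_nonneg (by norm_num) (Finset.sum_nonneg fun i _ => ?_)
  have := (B.eigenvalue_pos i).le
  positivity

theorem norm_modeSum_sq_le (S : Finset ι) (p q : ι → ℝ) :
    ‖B.modeSum S q‖ ^ 2 ≤ 2 * B.modeEnergy S p q := by
  rw [norm_modeSum_sq, modeEnergy, ← mul_assoc]
  norm_num
  refine Finset.sum_le_sum fun i _ => ?_
  have := mul_nonneg (B.eigenvalue_pos i).le (sq_nonneg (p i))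
  linarith

theorem modeSum_mem_graph (S : Finset ι) (p : ι → ℝ) :
    (B.modeSum S p, B.modeSum S fun i => B.eigenvalue i * p i) ∈ A.graph := by
  have h := A.graph.sum_mem (t := S) fun i _ => A.graph.smul_mem (p i) (B.mem_graph i)
  convert h using 1
  ext <;> simp [modeSum, Prod.fst_sum, Prod.snd_sum, smul_smul, mul_comm]

theorem modeSum_mem_sqrtOp_graph (S : Finset ι) (p : ι → ℝ) :
    (B.modeSum S p, B.modeSum S fun i => √(B.eigenvalue i) * p i) ∈ (sqrtOp A).graph := by
  have h := (sqrtOp A).graph.sum_mem (t := S) fun i _ =>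
    (sqrtOp A).graph.smul_mem (p i) (B.basis_mem_sqrtOp_graph i)
  convert h using 1
  ext <;> simp [modeSum, Prod.fst_sum, Prod.snd_sum, smul_smul, mul_comm]

theorem energy_modeSum (S : Finset ι) (p q : ι → ℝ) :
    energy A (B.modeSum S p) (B.modeSum S q) = B.modeEnergy S p q := by
  rw [energy, opVal_eq_of_mem_graph (B.modeSum_mem_sqrtOp_graph S p), norm_modeSum_sq,
    norm_modeSum_sq, modeEnergy, ← Finset.sum_add_distrib]
  simp only [mul_pow, Real.sq_sqrt (B.eigenvalue_pos _).le]

variable {B} {S : Finset ι} {a : ℝ → ℝ} {p q p' q' : ℝ → ι → ℝ}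

theorem continuousOn_modeSum (h : ∀ i ∈ S, ContinuousOn (fun t => q t i) (Set.Ici 0)) :
    ContinuousOn (fun t => B.modeSum S (q t)) (Set.Ici 0) :=
  continuousOn_finsetSum _ fun i hi => (h i hi).smul continuousOn_const

namespace IsModeSolution

theorem continuousOn_fst (h : B.IsModeSolution S a p q) {i : ι} (hi : i ∈ S) :
    ContinuousOn (fun t => p t i) (Set.Ici 0) :=
  fun t ht => (h t ht i hi).1.continuousWithinAt

theorem continuousOn_snd (h : B.IsModeSolution S a p q) {i : ι} (hi : i ∈ S) :
    ContinuousOn (fun t => q t i) (Set.Ici 0) :=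
  fun t ht => (h t ht i hi).2.continuousWithinAt

theorem continuousOn_velocity (h : B.IsModeSolution S a p q) :
    ContinuousOn (fun t => B.modeSum S (q t)) (Set.Ici 0) :=
  continuousOn_modeSum fun _ hi => h.continuousOn_snd hi

theorem smul (h : B.IsModeSolution S a p q) (r : ℝ) :
    B.IsModeSolution S a (fun t => r • p t) (fun t => r • q t) := by
  intro t ht i hi
  refine ⟨(h t ht i hi).1.const_mul r, ((h t ht i hi).2.const_mul r).congr_deriv ?_⟩
  simp only [Pi.smul_apply, smul_eq_mul]
  ring

/-- A finite span of modes is invariant because the damping is a scalar multiple of the velocity; on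
it, all regularity is automatic. -/
theorem isStrongSolution {C : H →L[ℝ] H} {ρ : ℝ → ℝ}
    (h : B.IsModeSolution S (fun t => ρ (‖C (B.modeSum S (q t))‖ ^ 2)) p q) :
    IsStrongSolution A C ρ (fun t => B.modeSum S (p t)) (fun t => B.modeSum S (q t)) where
  mem_domain t _ := mem_domain_of_mem_graph (B.modeSum_mem_graph S (p t))
  mem_sqrt_domain t _ := mem_domain_of_mem_graph (B.modeSum_mem_sqrtOp_graph S (p t))
  velocity_mem_sqrt_domain t _ := mem_domain_of_mem_graph (B.modeSum_mem_sqrtOp_graph S (q t))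
  continuousOn_op := by
    simp only [opVal_eq_of_mem_graph (B.modeSum_mem_graph S _)]
    exact continuousOn_modeSum fun i hi => continuousOn_const.mul (h.continuousOn_fst hi)
  continuousOn_sqrt := by
    simp only [opVal_eq_of_mem_graph (B.modeSum_mem_sqrtOp_graph S _)]
    exact continuousOn_modeSum fun i hi => continuousOn_const.mul (h.continuousOn_fst hi)
  continuousOn_sqrt_velocity := by
    simp only [opVal_eq_of_mem_graph (B.modeSum_mem_sqrtOp_graph S _)]
    exact continuousOn_modeSum fun i hi => continuousOn_const.mul (h.continuousOn_snd hi)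
  velocity t ht := HasDerivWithinAt.fun_sum fun i hi => (h t ht i hi).1.smul_const (B.basis i)
  equation t ht := by
    rw [opVal_eq_of_mem_graph (B.modeSum_mem_graph S _)]
    refine (HasDerivWithinAt.fun_sum fun i hi =>
      (h t ht i hi).2.smul_const (B.basis i)).congr_deriv ?_
    simp only [modeSum, Finset.smul_sum, smul_smul, ← Finset.sum_neg_distrib, ← neg_smul,
      ← Finset.sum_sub_distrib, ← sub_smul]

theorem hasDerivWithinAt_modeEnergy (h : B.IsModeSolution S a p q) {t : ℝ} (ht : 0 ≤ t) :
    HasDerivWithinAt (fun s => B.modeEnergy S (p s) (q s)) (-(a t * ‖B.modeSum S (q t)‖ ^ 2))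
      (Set.Ici 0) t := by
  refine ((HasDerivWithinAt.fun_sum (u := S) fun i hi => ((h t ht i hi).2.pow 2).add
    (((h t ht i hi).1.pow 2).const_mul (B.eigenvalue i))).const_mul (1 / 2 : ℝ)).congr_deriv ?_
  rw [norm_modeSum_sq, Finset.mul_sum, Finset.mul_sum, ← Finset.sum_neg_distrib]
  refine Finset.sum_congr rfl fun i _ => ?_
  simp only [Nat.add_one_sub_one, pow_one]
  push_cast
  ring

/-- Distance in energy between a damped and a conservative solution with the same data, in terms
of the dissipated energy. -/
theorem modeEnergy_sub_le (h : B.IsModeSolution S a p q)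
    (h' : B.IsModeSolution S (fun _ => 0) p' q') (hp : p 0 = p' 0) (hq : q 0 = q' 0)
    {L T : ℝ} (ha0 : ∀ t ∈ Set.Icc 0 T, 0 ≤ a t) (haL : ∀ t ∈ Set.Icc 0 T, a t ≤ L)
    {t : ℝ} (ht : t ∈ Set.Icc 0 T) :
    2 * B.modeEnergy S (p t - p' t) (q t - q' t) ≤
      Real.exp t * (L * (B.modeEnergy S (p 0) (q 0) - B.modeEnergy S (p t) (q t))) := by
  have hsub : Set.Icc (0 : ℝ) T ⊆ Set.Ici 0 := Set.Icc_subset_Ici_self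
  have hD : ∀ s, 0 ≤ s → HasDerivWithinAt
      (fun s => ∑ i ∈ S, ((q s i - q' s i) ^ 2 + B.eigenvalue i * (p s i - p' s i) ^ 2))
      (∑ i ∈ S, -(2 * (a s * (q s i * (q s i - q' s i))))) (Set.Ici 0) s := by
    intro s hs
    refine (HasDerivWithinAt.fun_sum (u := S) fun i hi =>
      (((h s hs i hi).2.sub (h' s hs i hi).2).pow 2).add
      ((((h s hs i hi).1.sub (h' s hs i hi).1).pow 2).const_mul (B.eigenvalue i))).congr_deriv ?_
    refine Finset.sum_congr rfl fun i _ => ?_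
    simp only [Nat.add_one_sub_one, pow_one, Pi.sub_apply]
    push_cast
    ring
  -- Gronwall as a Lyapunov functional: the factor exp(-s) absorbs the energy of the difference, and
  -- L times the damped energy absorbs the source term.
  have hG : ∀ s, 0 ≤ s → HasDerivWithinAt (fun s => Real.exp (-s) *
      (∑ i ∈ S, ((q s i - q' s i) ^ 2 + B.eigenvalue i * (p s i - p' s i) ^ 2)) +
      L * B.modeEnergy S (p s) (q s)) _ (Set.Ici 0) s := fun s hs =>
    (((hasDerivAt_neg s).exp.hasDerivWithinAt).mul (hD s hs)).add
      ((h.hasDerivWithinAt_modeEnergy hs).const_mul L)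
  have hanti := antitoneOn_of_hasDerivWithinAt_nonpos (convex_Icc 0 T)
    (fun s hs => ((hG s (hsub hs)).mono hsub).continuousWithinAt)
    (fun s hs => (hG s (hsub (interior_subset hs))).mono (interior_subset.trans hsub)) ?_
  · have h1 := hanti ⟨le_rfl, ht.1.trans ht.2⟩ ht ht.1
    simp only [hp, hq, sub_self] at h1
    have h2 : Real.exp t * Real.exp (-t) = 1 := by rw [← Real.exp_add]; simp
    have h3 : 2 * B.modeEnergy S (p t - p' t) (q t - q' t) =
        ∑ i ∈ S, ((q t i - q' t i) ^ 2 + B.eigenvalue i * (p t i - p' t i) ^ 2) := by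
      rw [modeEnergy, ← mul_assoc]; norm_num
    rw [h3, hp, hq]
    have h4 := mul_le_mul_of_nonneg_left h1 (Real.exp_pos t).le
    rw [mul_add, ← mul_assoc, h2] at h4
    norm_num at h4
    linarith
  · intro s hs
    have hs' := interior_subset hs
    have h1 : ∑ i ∈ S, -(2 * (a s * (q s i * (q s i - q' s i)))) ≤
        ∑ i ∈ S, (((q s i - q' s i) ^ 2 + B.eigenvalue i * (p s i - p' s i) ^ 2) +
          a s ^ 2 * q s i ^ 2) := by
      refine Finset.sum_le_sum fun i _ => ?_
      have := mul_nonneg (B.eigenvalue_pos i).le (sq_nonneg (p s i - p' s i))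
      nlinarith [sq_nonneg ((q s i - q' s i) + a s * q s i)]
    rw [Finset.sum_add_distrib, ← Finset.mul_sum, ← B.norm_modeSum_sq] at h1
    have h2 : Real.exp (-s) ≤ 1 := Real.exp_le_one_iff.2 (by linarith [hs'.1])
    -- This turns the source a²‖q‖² into L times the dissipation rate.
    have h3 : a s ^ 2 ≤ L * a s := by nlinarith [ha0 s hs', haL s hs']
    have h4 := Real.exp_pos (-s)
    have h5 : Real.exp (-s) * (a s ^ 2 * ‖B.modeSum S (q s)‖ ^ 2) ≤
        1 * (L * a s * ‖B.modeSum S (q s)‖ ^ 2) := by gcongr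
    have h6 := mul_le_mul_of_nonneg_left h1 h4.le
    linarith

end IsModeSolution
end EigenBasis

end

/-! ### Observability on finite spans of modes. -/

section

variable {H : Type u} [NormedAddCommGroup H] [InnerProductSpace ℝ H] [CompleteSpace H]

theorem continuous_damping {ρ : ℝ → ℝ} (hρ : ContinuousOn ρ (Set.Ici 0)) (C : H →L[ℝ] H) :
    Continuous fun x : H => ρ (‖C x‖ ^ 2) :=
  hρ.comp_continuous (by fun_prop) fun x => Set.mem_Ici.2 (by positivity)

theorem integral_norm_sq_le_of_norm_sub_sq_le {x y : ℝ → H} {T δ : ℝ} (hT : 0 ≤ T)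
    (hx : ContinuousOn x (Set.Icc 0 T)) (hy : ContinuousOn y (Set.Icc 0 T))
    (h : ∀ t ∈ Set.Icc 0 T, ‖x t - y t‖ ^ 2 ≤ δ) :
    ∫ t in (0 : ℝ)..T, ‖x t‖ ^ 2 ≤ 2 * (∫ t in (0 : ℝ)..T, ‖y t‖ ^ 2) + 2 * T * δ := by
  have hi : ∀ {z : ℝ → H}, ContinuousOn z (Set.Icc 0 T) →
      IntervalIntegrable (fun t => ‖z t‖ ^ 2) MeasureTheory.volume 0 T := fun hz =>
    (hz.norm.pow 2).intervalIntegrable_of_Icc hT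
  have h1 : ∫ t in (0 : ℝ)..T, ‖x t‖ ^ 2 ≤ ∫ t in (0 : ℝ)..T, (2 * ‖y t‖ ^ 2 + 2 * δ) := by
    refine intervalIntegral.integral_mono_on hT (hi hx)
      (((hi hy).const_mul 2).add (by simp)) fun t ht => ?_
    have h2 := h t ht
    have h3 : ‖x t‖ ≤ ‖x t - y t‖ + ‖y t‖ := by simpa using norm_add_le (x t - y t) (y t)
    nlinarith [norm_nonneg (x t), norm_nonneg (y t), norm_nonneg (x t - y t),
      sq_nonneg (‖x t - y t‖ - ‖y t‖)]
  refine h1.trans (le_of_eq ?_)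
  rw [intervalIntegral.integral_add ((hi hy).const_mul 2) (by simp),
    intervalIntegral.integral_const_mul, intervalIntegral.integral_const, smul_eq_mul]
  ring

namespace EigenBasis

variable {A : H →ₗ.[ℝ] H} {ι : Type u} (B : EigenBasis A ι)

/-- Every initial datum in a finite span of modes has a solution of the equation with damping
coefficient `g (u_t)` in that span. -/
theorem exists_isModeSolution {g : H → ℝ} (hg : Continuous g) (hg0 : ∀ x, 0 ≤ g x)
    (S : Finset ι) (p₀ q₀ : ι → ℝ) : ∃ p q : ℝ → ι → ℝ, p 0 = p₀ ∧ q 0 = q₀ ∧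
      B.IsModeSolution S (fun t => g (B.modeSum S (q t))) p q := by
  classical
  obtain ⟨P, Q, hP, hQ, h⟩ := exists_damped_oscillators (κ := S)
    (lam := fun i => B.eigenvalue i) (fun i => B.eigenvalue_pos i)
    (g := fun x => g (∑ i, x i • B.basis i)) (by fun_prop) (fun _ => hg0 _)
    (fun i => p₀ i) (fun i => q₀ i)
  -- Modes outside S are frozen, so that the initial data agree as functions on all of ι.
  refine ⟨fun t i => if hi : i ∈ S then P t ⟨i, hi⟩ else p₀ i,
    fun t i => if hi : i ∈ S then Q t ⟨i, hi⟩ else q₀ i, ?_, ?_, ?_⟩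
  · ext i; simp [hP]
  · ext i; simp [hQ]
  · intro t ht i hi
    have hsum : B.modeSum S (fun i => if hi : i ∈ S then Q t ⟨i, hi⟩ else q₀ i) =
        ∑ i, Q t i • B.basis i := by
      rw [modeSum, ← Finset.sum_coe_sort]
      exact Finset.sum_congr rfl fun i _ => by simp
    simpa only [hi, dif_pos, hsum] using h t ht ⟨i, hi⟩

/-- Observability of the conservative equation on all finite spans of modes. -/
def ModeObservable (C : H →L[ℝ] H) (T c : ℝ) : Prop :=
  ∀ (S : Finset ι) (p q : ℝ → ι → ℝ), B.IsModeSolution S (fun _ => 0) p q →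
    c * B.modeEnergy S (p 0) (q 0) ≤ ∫ t in (0 : ℝ)..T, ‖C (B.modeSum S (q t))‖ ^ 2

theorem modeObservable_of_linearlyObservable {C : H →L[ℝ] H} (h : LinearlyObservable A C) :
    ∃ T > 0, ∃ c > 0, B.ModeObservable C T c := by
  obtain ⟨T, hT, c, hc, hobs⟩ := h
  refine ⟨T, hT, c, hc, fun S p q hpq => ?_⟩
  have := hobs _ _ (IsModeSolution.isStrongSolution (C := C) (ρ := fun _ => 0) hpq)
  rwa [B.energy_modeSum] at this

variable {B} {S : Finset ι} {a : ℝ → ℝ} {p q p' q' : ℝ → ι → ℝ}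

theorem IsModeSolution.antitoneOn_modeEnergy (h : B.IsModeSolution S a p q)
    (ha : ∀ t, 0 ≤ t → 0 ≤ a t) :
    AntitoneOn (fun t => B.modeEnergy S (p t) (q t)) (Set.Ici 0) := by
  refine antitoneOn_of_hasDerivWithinAt_nonpos (convex_Ici 0)
    (fun t ht => (h.hasDerivWithinAt_modeEnergy ht).continuousWithinAt)
    (fun t ht => (h.hasDerivWithinAt_modeEnergy (interior_subset ht)).mono interior_subset)
    fun t ht => ?_
  have := mul_nonneg (ha t (interior_subset ht)) (sq_nonneg ‖B.modeSum S (q t)‖)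
  linarith

theorem IsModeSolution.modeEnergy_eq (h : B.IsModeSolution S (fun _ => 0) p q) {t : ℝ}
    (ht : 0 ≤ t) : B.modeEnergy S (p t) (q t) = B.modeEnergy S (p 0) (q 0) := by
  refine le_antisymm (h.antitoneOn_modeEnergy (fun _ _ => le_rfl) Set.self_mem_Ici ht ht) ?_
  refine monotoneOn_of_hasDerivWithinAt_nonneg (convex_Ici 0)
    (fun t ht => (h.hasDerivWithinAt_modeEnergy ht).continuousWithinAt)
    (fun t ht => (h.hasDerivWithinAt_modeEnergy (interior_subset ht)).mono interior_subset)
    (fun t ht => ?_) Set.self_mem_Ici ht ht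
  simp

/-- The velocities of a damped and a conservative solution with the same data, seen through `C`. -/
theorem IsModeSolution.norm_map_sub_sq_le (C : H →L[ℝ] H) (h : B.IsModeSolution S a p q)
    (h' : B.IsModeSolution S (fun _ => 0) p' q') (hp : p 0 = p' 0) (hq : q 0 = q' 0)
    {L T : ℝ} (hL : 0 ≤ L) (ha0 : ∀ t, 0 ≤ t → 0 ≤ a t) (haL : ∀ t ∈ Set.Icc 0 T, a t ≤ L)
    {t : ℝ} (ht : t ∈ Set.Icc 0 T) :
    ‖C (B.modeSum S (q t)) - C (B.modeSum S (q' t))‖ ^ 2 ≤ ‖C‖ ^ 2 * (Real.exp T *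
      (L * (B.modeEnergy S (p 0) (q 0) - B.modeEnergy S (p T) (q T)))) := by
  have h1 := h.modeEnergy_sub_le h' hp hq (fun t ht => ha0 t ht.1) haL ht
  have h2 := B.norm_modeSum_sq_le S (p t - p' t) (q t - q' t)
  have h3 := h.antitoneOn_modeEnergy ha0 (Set.mem_Ici.2 ht.1)
    (Set.mem_Ici.2 (ht.1.trans ht.2)) ht.2
  simp only at h3
  rw [← map_sub, ← B.modeSum_sub]
  calc ‖C (B.modeSum S (q t - q' t))‖ ^ 2 ≤ (‖C‖ * ‖B.modeSum S (q t - q' t)‖) ^ 2 := by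
        gcongr; exact C.le_opNorm _
    _ = ‖C‖ ^ 2 * ‖B.modeSum S (q t - q' t)‖ ^ 2 := by ring
    _ ≤ ‖C‖ ^ 2 * (Real.exp t *
      (L * (B.modeEnergy S (p 0) (q 0) - B.modeEnergy S (p t) (q t)))) := by
        gcongr; exact h2.trans h1
    _ ≤ _ := by
        have h5 := h.antitoneOn_modeEnergy ha0 Set.self_mem_Ici (Set.mem_Ici.2 ht.1) ht.1
        have := mul_nonneg hL (sub_nonneg.2 h5)
        gcongr
        exact ht.2

theorem IsModeSolution.continuousOn_map_velocity (C : H →L[ℝ] H)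
    (h : B.IsModeSolution S a p q) (T : ℝ) :
    ContinuousOn (fun t => C (B.modeSum S (q t))) (Set.Icc 0 T) :=
  C.continuous.comp_continuousOn (h.continuousOn_velocity.mono Set.Icc_subset_Ici_self)

/-- Replacing the observed conservative velocity by the damped one costs only a multiple of the
dissipated energy. -/
theorem ModeObservable.le_of_isModeSolution {C : H →L[ℝ] H} {T c : ℝ} (hT : 0 ≤ T)
    (hobs : B.ModeObservable C T c) (h : B.IsModeSolution S a p q) {L : ℝ} (hL : 0 ≤ L)
    (ha0 : ∀ t, 0 ≤ t → 0 ≤ a t) (haL : ∀ t ∈ Set.Icc 0 T, a t ≤ L) :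
    c * B.modeEnergy S (p 0) (q 0) ≤
      2 * (∫ t in (0 : ℝ)..T, ‖C (B.modeSum S (q t))‖ ^ 2) +
      2 * T * (‖C‖ ^ 2 * (Real.exp T *
        (L * (B.modeEnergy S (p 0) (q 0) - B.modeEnergy S (p T) (q T))))) := by
  obtain ⟨p', q', hp, hq, h'⟩ := B.exists_isModeSolution (g := fun _ => 0) continuous_const
    (fun _ => le_rfl) S (p 0) (q 0)
  have h1 := hobs S p' q' h'
  rw [hp, hq] at h1
  refine h1.trans (integral_norm_sq_le_of_norm_sub_sq_le hT (h'.continuousOn_map_velocity C T)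
    (h.continuousOn_map_velocity C T) fun t ht => ?_)
  rw [norm_sub_rev]
  exact h.norm_map_sub_sq_le C h' hp.symm hq.symm hL ha0 haL ht

variable (B)

theorem modeEnergy_le_two_mul_add (S : Finset ι) (p q p' q' : ι → ℝ) :
    B.modeEnergy S p' q' ≤ 2 * B.modeEnergy S p q + 2 * B.modeEnergy S (p - p') (q - q') := by
  simp only [modeEnergy, Finset.mul_sum, ← Finset.sum_add_distrib]
  refine Finset.sum_le_sum fun i _ => ?_
  simp only [Pi.sub_apply]
  have := (B.eigenvalue_pos i).le
  nlinarith [sq_nonneg (2 * q i - q' i), mul_nonneg this (sq_nonneg (2 * p i - p' i))]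

/-- Observability along the damped flow implies observability of the conservative equation, by
linearization at the rest state. -/
theorem modeObservable_of_integrallyObservable {C : H →L[ℝ] H} {ρ : ℝ → ℝ}
    (hρ : ContinuousOn ρ (Set.Ici 0)) (hρ_nonneg : ∀ s, 0 ≤ s → 0 ≤ ρ s) (hρ0 : ρ 0 = 0)
    (h : IntegrallyObservable A C ρ) : ∃ T > 0, ∃ c > 0, B.ModeObservable C T c := by
  obtain ⟨T, hT, c, hc, hobs⟩ := h
  refine ⟨T, hT, c * T / 8, by positivity, fun S p' q' h' => ?_⟩
  set E₀ := B.modeEnergy S (p' 0) (q' 0) with hE₀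
  have hE₀0 : 0 ≤ E₀ := B.modeEnergy_nonneg _ _ _
  -- With this L the comparison errors use up cTE₀/4 of the available cTE₀/2; halving what remains
  -- gives the constant cT/8.
  obtain ⟨L, hL, hLc⟩ : ∃ L > 0, Real.exp T * L * (c / 2 + 2 * ‖C‖ ^ 2) = c / 4 := by
    have := Real.exp_pos T
    exact ⟨c / 4 / (Real.exp T * (c / 2 + 2 * ‖C‖ ^ 2)), by positivity, by field_simp⟩
  obtain ⟨s₀, hs₀, hρL⟩ : ∃ s₀ > 0, ∀ s ∈ Set.Icc 0 s₀, ρ s ≤ L := by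
    have h1 : ∀ᶠ s in 𝓝[≥] (0 : ℝ), ρ s < L :=
      (hρ 0 Set.self_mem_Ici).tendsto.eventually_lt_const (by rw [hρ0]; exact hL)
    obtain ⟨s₀, hs₀, h2⟩ := mem_nhdsGE_iff_exists_Icc_subset.1 h1
    exact ⟨s₀, hs₀, fun s hs => (h2 hs).le⟩
  obtain ⟨ε, hε, hεs⟩ : ∃ ε > 0, ε ^ 2 * (2 * ‖C‖ ^ 2 * E₀) ≤ s₀ := by
    refine ⟨√(s₀ / (2 * ‖C‖ ^ 2 * E₀ + 1)), Real.sqrt_pos.2 (by positivity), ?_⟩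
    rw [Real.sq_sqrt (by positivity), div_mul_eq_mul_div, div_le_iff₀ (by positivity)]
    nlinarith
  obtain ⟨P, Q, hP, hQ, hPQ⟩ := B.exists_isModeSolution (continuous_damping hρ C)
    (fun x => hρ_nonneg _ (by positivity)) S (ε • p' 0) (ε • q' 0)
  have ha0 : ∀ t, 0 ≤ t → 0 ≤ ρ (‖C (B.modeSum S (Q t))‖ ^ 2) :=
    fun t _ => hρ_nonneg _ (by positivity)
  have haL : ∀ t ∈ Set.Icc 0 T, ρ (‖C (B.modeSum S (Q t))‖ ^ 2) ≤ L := by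
    intro t ht
    refine hρL _ ⟨by positivity, ?_⟩
    have h1 := hPQ.antitoneOn_modeEnergy ha0 Set.self_mem_Ici (Set.mem_Ici.2 ht.1) ht.1
    simp only [hP, hQ, modeEnergy_smul, ← hE₀] at h1
    calc ‖C (B.modeSum S (Q t))‖ ^ 2 ≤ (‖C‖ * ‖B.modeSum S (Q t)‖) ^ 2 := by
          gcongr; exact C.le_opNorm _
      _ = ‖C‖ ^ 2 * ‖B.modeSum S (Q t)‖ ^ 2 := by ring
      _ ≤ ‖C‖ ^ 2 * (2 * (ε ^ 2 * E₀)) := by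
          gcongr
          exact (B.norm_modeSum_sq_le S (P t) (Q t)).trans (by linarith)
      _ ≤ s₀ := by linarith
  have h1 := hobs _ _ (IsModeSolution.isStrongSolution hPQ) 0 le_rfl
  simp only [B.energy_modeSum, zero_add] at h1
  -- rescaling to the original data
  set p : ℝ → ι → ℝ := fun t => ε⁻¹ • P t with hp
  set q : ℝ → ι → ℝ := fun t => ε⁻¹ • Q t with hq
  -- With its coefficient regarded as a given function of time, the system is linear: the rescaled
  -- pair keeps the coefficient of the small solution.
  have hpq := hPQ.smul ε⁻¹
  have hPp : ∀ t, P t = ε • p t := fun t => by simp [hp, smul_smul, hε.ne']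
  have hQq : ∀ t, Q t = ε • q t := fun t => by simp [hq, smul_smul, hε.ne']
  have hp0 : p 0 = p' 0 := by simp [hp, hP, smul_smul, hε.ne']
  have hq0 : q 0 = q' 0 := by simp [hq, hQ, smul_smul, hε.ne']
  have h2 : c * ∫ t in (0 : ℝ)..T, B.modeEnergy S (p t) (q t) ≤
      ∫ t in (0 : ℝ)..T, ‖C (B.modeSum S (q t))‖ ^ 2 := by
    simp only [hPp, hQq, modeEnergy_smul, modeSum_smul, map_smul, norm_smul, mul_pow,
      intervalIntegral.integral_const_mul, Real.norm_eq_abs, sq_abs] at h1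
    have : 0 < ε ^ 2 := by positivity
    nlinarith
  have hET0 : 0 ≤ B.modeEnergy S (p T) (q T) := B.modeEnergy_nonneg _ _ _
  have h3 : ∫ t in (0 : ℝ)..T, ‖C (B.modeSum S (q t))‖ ^ 2 ≤
      2 * (∫ t in (0 : ℝ)..T, ‖C (B.modeSum S (q' t))‖ ^ 2) +
        2 * T * (‖C‖ ^ 2 * (Real.exp T * (L * E₀))) := by
    refine integral_norm_sq_le_of_norm_sub_sq_le hT.le (hpq.continuousOn_map_velocity C T)
      (h'.continuousOn_map_velocity C T) fun t ht => ?_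
    refine (hpq.norm_map_sub_sq_le C h' hp0 hq0 hL.le ha0 haL ht).trans ?_
    gcongr
    have : B.modeEnergy S (p 0) (q 0) = E₀ := by rw [hp0, hq0]
    change B.modeEnergy S (p 0) (q 0) - B.modeEnergy S (p T) (q T) ≤ E₀
    linarith
  -- The conservative energy is constantly E₀ and is at most twice the damped energy plus twice that
  -- of the difference.
  have h4 : T * ((E₀ - Real.exp T * (L * E₀)) / 2) ≤
      ∫ t in (0 : ℝ)..T, B.modeEnergy S (p t) (q t) := by
    have h5 : ∫ _ in (0 : ℝ)..T, (E₀ - Real.exp T * (L * E₀)) / 2 =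
        T * ((E₀ - Real.exp T * (L * E₀)) / 2) := by
      rw [intervalIntegral.integral_const, sub_zero, smul_eq_mul]
    rw [← h5]
    refine intervalIntegral.integral_mono_on hT.le (by simp) ?_ fun t ht => ?_
    · exact ContinuousOn.intervalIntegrable_of_Icc hT.le fun t ht =>
        ((hpq.hasDerivWithinAt_modeEnergy ht.1).continuousWithinAt).mono Set.Icc_subset_Ici_self
    · have h6 := B.modeEnergy_le_two_mul_add S (p t) (q t) (p' t) (q' t)
      rw [h'.modeEnergy_eq ht.1, ← hE₀] at h6
      have h7 : 2 * B.modeEnergy S (p t - p' t) (q t - q' t) ≤ _ :=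
        hpq.modeEnergy_sub_le h' hp0 hq0 (fun t ht => ha0 t ht.1) haL ht
      have h8 : Real.exp t * (L * (B.modeEnergy S (p 0) (q 0) - B.modeEnergy S (p t) (q t))) ≤
          Real.exp T * (L * E₀) := by
        have h9 : B.modeEnergy S (p 0) (q 0) = E₀ := by rw [hp0, hq0]
        have h10 := B.modeEnergy_nonneg S (p t) (q t)
        rw [h9]
        calc Real.exp t * (L * (E₀ - B.modeEnergy S (p t) (q t)))
            ≤ Real.exp t * (L * E₀) := by gcongr; linarith
          _ ≤ _ := by gcongr; exact ht.2
      linarith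
  have h5 := mul_le_mul_of_nonneg_left h4 hc.le
  have h6 : Real.exp T * L * (c / 2 + 2 * ‖C‖ ^ 2) * (T * E₀) = c / 4 * (T * E₀) := by rw [hLc]
  linarith

end EigenBasis

end

/-! ### Finite energy solutions as limits of their modes. -/

section

variable {H : Type u} [NormedAddCommGroup H] [InnerProductSpace ℝ H] [CompleteSpace H]
variable {A : H →ₗ.[ℝ] H} {C : H →L[ℝ] H} {ρ : ℝ → ℝ} {u v : ℝ → H}

theorem energy_nonneg (A : H →ₗ.[ℝ] H) (u v : H) : 0 ≤ energy A u v := by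
  unfold energy; positivity

theorem norm_sq_le_energy (A : H →ₗ.[ℝ] H) (u v : H) : ‖v‖ ^ 2 ≤ 2 * energy A u v := by
  unfold energy
  linarith [sq_nonneg ‖opVal (sqrtOp A) u‖]

namespace IsWeakSolution

theorem shift (h : IsWeakSolution A C ρ u v) {s : ℝ} (hs : 0 ≤ s) :
    IsWeakSolution A C ρ (fun t => u (s + t)) (fun t => v (s + t)) := by
  have hm : Set.MapsTo (fun t => s + t) (Set.Ici 0) (Set.Ici 0) :=
    fun t ht => add_nonneg hs ht
  have hc : ContinuousOn (fun t : ℝ => s + t) (Set.Ici 0) := by fun_prop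
  have hd : ∀ t, HasDerivWithinAt (fun t : ℝ => s + t) 1 (Set.Ici 0) t := fun t =>
    ((hasDerivAt_id t).const_add s).hasDerivWithinAt
  refine ⟨fun t ht => h.mem_sqrt_domain _ (hm ht), h.continuousOn_sqrt.comp hc hm,
    fun t ht => ?_, h.continuousOn_velocity.comp hc hm, fun φ hφ t ht => ?_⟩
  · exact ((h.velocity _ (hm ht)).scomp t (hd t) hm).congr_deriv (one_smul _ _)
  · exact ((h.equation φ hφ _ (hm ht)).scomp t (hd t) hm).congr_deriv (one_smul _ _)

variable {ι : Type u} (B : EigenBasis A ι)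

/-- The weak equation is tested with basis vectors. The coefficient involves the full velocity, not
its truncation, so it is the same for every S. -/
theorem isModeSolution (h : IsWeakSolution A C ρ u v) (S : Finset ι) :
    B.IsModeSolution S (fun t => ρ (‖C (v t)‖ ^ 2)) (fun t i => B.coord i (u t))
      (fun t i => B.coord i (v t)) := by
  intro t ht i _
  constructor
  · have h1 := (h.velocity t ht).inner ℝ (hasDerivWithinAt_const t (Set.Ici 0) (B.basis i))
    simpa [EigenBasis.coord] using h1
  · have hb := B.basis_mem_sqrtOp_graph i
    refine (h.equation _ (mem_domain_of_mem_graph hb) t ht).congr_deriv ?_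
    have h2 := B.coord_sqrtOp (mem_graph_opVal (h.mem_sqrt_domain t ht)) i
    rw [EigenBasis.coord] at h2
    rw [opVal_eq_of_mem_graph hb, real_inner_smul_right, h2, ← mul_assoc,
      Real.mul_self_sqrt (B.eigenvalue_pos i).le]
    rfl

theorem tendsto_modeEnergy (h : IsWeakSolution A C ρ u v) {t : ℝ} (ht : 0 ≤ t) :
    Tendsto (fun S => B.modeEnergy S (fun i => B.coord i (u t)) (fun i => B.coord i (v t))) atTop
      (𝓝 (energy A (u t) (v t))) := by
  have := B.hasSum_energy (h.mem_sqrt_domain t ht) (v t)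
  simp only [EigenBasis.modeEnergy, Finset.mul_sum]
  exact this

theorem antitoneOn_energy (hA : IsPositiveCompactInverse A) (hρ : ∀ s, 0 ≤ s → 0 ≤ ρ s)
    (h : IsWeakSolution A C ρ u v) :
    AntitoneOn (fun t => energy A (u t) (v t)) (Set.Ici 0) := by
  obtain ⟨ι, -, ⟨B⟩⟩ := hA.exists_eigenBasis
  intro s hs t ht hst
  refine le_of_tendsto_of_tendsto' (h.tendsto_modeEnergy B ht) (h.tendsto_modeEnergy B hs)
    fun S => ?_
  exact (h.isModeSolution B S).antitoneOn_modeEnergy (fun _ _ => hρ _ (by positivity)) hs ht hst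

theorem tendsto_modeSum (B : EigenBasis A ι) (x : H) :
    Tendsto (fun S => B.modeSum S fun i => B.coord i x) atTop (𝓝 x) :=
  B.hasSum_coord_smul x

theorem norm_modeSum_coord_le (B : EigenBasis A ι) (S : Finset ι) (x : H) :
    ‖B.modeSum S fun i => B.coord i x‖ ≤ ‖x‖ := by
  refine le_of_sq_le_sq ?_ (norm_nonneg _)
  rw [B.norm_modeSum_sq]
  exact sum_le_hasSum S (fun _ _ => sq_nonneg _) (B.hasSum_coord_sq x)

/-- Dominated convergence, the majorant coming from Bessel's inequality. -/
theorem tendsto_integral_modeSum [Countable ι] (B : EigenBasis A ι) (D : H →L[ℝ] H) {a : ℝ → ℝ}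
    {T : ℝ} (hT : 0 ≤ T) (ha : ContinuousOn a (Set.Icc 0 T)) (hv : ContinuousOn v (Set.Icc 0 T)) :
    Tendsto (fun S => ∫ t in (0 : ℝ)..T, a t * ‖D (B.modeSum S fun i => B.coord i (v t))‖ ^ 2)
      atTop (𝓝 (∫ t in (0 : ℝ)..T, a t * ‖D (v t)‖ ^ 2)) := by
  refine intervalIntegral.tendsto_integral_filter_of_dominated_convergence
    (fun t => |a t| * (‖D‖ * ‖v t‖) ^ 2) (Eventually.of_forall fun S => ?_)
    (Eventually.of_forall fun S => MeasureTheory.ae_of_all _ fun t _ => ?_) ?_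
    (MeasureTheory.ae_of_all _ fun t _ => ?_)
  · have h1 : ContinuousOn (fun t => B.modeSum S fun i => B.coord i (v t)) (Set.Icc 0 T) :=
      continuousOn_finsetSum _ fun i _ => (hv.inner continuousOn_const).smul continuousOn_const
    have h2 := ha.mul ((D.continuous.comp_continuousOn h1).norm.pow 2)
    exact (h2.intervalIntegrable_of_Icc hT).def'.aestronglyMeasurable
  · rw [norm_mul, norm_pow, norm_norm, Real.norm_eq_abs]
    gcongr
    exact (D.le_opNorm _).trans (by gcongr; exact norm_modeSum_coord_le B S _)
  · exact (ha.abs.mul ((continuousOn_const.mul hv.norm).pow 2)).intervalIntegrable_of_Icc hT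
  · exact (((D.continuous.tendsto _).comp (tendsto_modeSum B (v t))).norm.pow 2).const_mul _

theorem continuousOn_damping (hρ : ContinuousOn ρ (Set.Ici 0)) (h : IsWeakSolution A C ρ u v) :
    ContinuousOn (fun t => ρ (‖C (v t)‖ ^ 2)) (Set.Ici 0) :=
  (continuous_damping hρ C).comp_continuousOn h.continuousOn_velocity

/-- The energy identity. -/
theorem integral_dissipation_eq (hA : IsPositiveCompactInverse A)
    (hρ : ContinuousOn ρ (Set.Ici 0)) (h : IsWeakSolution A C ρ u v) {T : ℝ} (hT : 0 ≤ T) :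
    ∫ t in (0 : ℝ)..T, ρ (‖C (v t)‖ ^ 2) * ‖v t‖ ^ 2 =
      energy A (u 0) (v 0) - energy A (u T) (v T) := by
  obtain ⟨ι, _, ⟨B⟩⟩ := hA.exists_eigenBasis
  have hsub : Set.Icc (0 : ℝ) T ⊆ Set.Ici 0 := Set.Icc_subset_Ici_self
  have h1 := tendsto_integral_modeSum B (.id ℝ H) hT ((h.continuousOn_damping hρ).mono hsub)
    (h.continuousOn_velocity.mono hsub)
  refine tendsto_nhds_unique h1 (((h.tendsto_modeEnergy B le_rfl).sub
    (h.tendsto_modeEnergy B hT)).congr fun S => ?_)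
  have hS := h.isModeSolution B S
  have h2 := intervalIntegral.integral_eq_sub_of_hasDeriv_right_of_le hT
    (fun t ht => ((hS.hasDerivWithinAt_modeEnergy (hsub ht)).continuousWithinAt).mono hsub)
    (fun t ht => (hS.hasDerivWithinAt_modeEnergy ht.1.le).mono
      (Set.Ioi_subset_Ici_self.trans (Set.Ici_subset_Ici.2 ht.1.le)))
    (ContinuousOn.intervalIntegrable_of_Icc hT
      ((((h.continuousOn_damping hρ).mono hsub).mul
        ((hS.continuousOn_velocity.mono hsub).norm.pow 2)).neg))
  rw [intervalIntegral.integral_neg] at h2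
  simp only [ContinuousLinearMap.id_apply]
  linarith

/-- The constants c, T and L do not depend on S, so the estimate on modes survives the limit. -/
theorem _root_.DampedWave.EigenBasis.ModeObservable.le_of_isWeakSolution [Countable ι]
    {B : EigenBasis A ι} {T c : ℝ} (hT : 0 ≤ T) (hobs : B.ModeObservable C T c)
    (hρ_nonneg : ∀ s, 0 ≤ s → 0 ≤ ρ s) (h : IsWeakSolution A C ρ u v) {L : ℝ} (hL : 0 ≤ L)
    (haL : ∀ t, 0 ≤ t → ρ (‖C (v t)‖ ^ 2) ≤ L) :
    c * energy A (u 0) (v 0) ≤ 2 * (∫ t in (0 : ℝ)..T, ‖C (v t)‖ ^ 2) +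
      2 * T * (‖C‖ ^ 2 * (Real.exp T *
        (L * (energy A (u 0) (v 0) - energy A (u T) (v T))))) := by
  have h0 := h.tendsto_modeEnergy B le_rfl
  have h1 := h.tendsto_modeEnergy B hT
  have h2 := tendsto_integral_modeSum B C hT (continuousOn_const (c := (1 : ℝ)))
    (h.continuousOn_velocity.mono Set.Icc_subset_Ici_self)
  simp only [one_mul] at h2
  refine le_of_tendsto_of_tendsto' (h0.const_mul c) ((h2.const_mul 2).add
    (((((h0.sub h1).const_mul L).const_mul (Real.exp T)).const_mul (‖C‖ ^ 2)).const_mul (2 * T)))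
    fun S => ?_
  exact hobs.le_of_isModeSolution hT (h.isModeSolution B S) hL
    (fun _ _ => hρ_nonneg _ (by positivity)) fun t ht => haL t ht.1

end IsWeakSolution

end

/-! ### Scalar inequalities behind the decay rate. -/

theorem rpow_neg_add_le_rpow_neg {y y' κ γ : ℝ} (hy : 0 < y) (hy' : 0 < y') (hγ : 0 < γ)
    (h : κ * y ^ (1 + γ) ≤ y - y') : y ^ (-γ) + γ * κ ≤ y' ^ (-γ) := by
  have hyγ : y ^ (-γ) * y ^ γ = 1 := by rw [← Real.rpow_add hy]; simp
  -- The bound 1 + x ≤ exp x is used here and again after raising to the power -γ; it replaces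
  -- integration of y' = -κ y^(1+γ).
  have h1 : y' ≤ y * Real.exp (-(κ * y ^ γ)) := by
    have h2 := Real.add_one_le_exp (-(κ * y ^ γ))
    rw [Real.rpow_add hy, Real.rpow_one] at h
    nlinarith
  have h3 : (y * Real.exp (-(κ * y ^ γ))) ^ (-γ) ≤ y' ^ (-γ) :=
    Real.rpow_le_rpow_of_nonpos hy' h1 (by linarith)
  refine le_trans ?_ h3
  rw [Real.mul_rpow hy.le (Real.exp_pos _).le, ← Real.exp_mul]
  have h4 := Real.add_one_le_exp (-(κ * y ^ γ) * -γ)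
  calc y ^ (-γ) + γ * κ = y ^ (-γ) * (-(κ * y ^ γ) * -γ + 1) := by
        linear_combination (-γ * κ) * hyγ
    _ ≤ _ := by gcongr

/-- A nonincreasing function satisfying `κ f(s)^(1+γ) ≤ f(s) - f(s+T)` decays like
`t^(-1/γ)` (Nakao). -/
theorem exists_forall_le_div_one_add_rpow {M T κ γ : ℝ} (hM : 0 < M) (hT : 0 < T) (hκ : 0 < κ)
    (hγ : 0 < γ) : ∃ K : ℝ, 0 < K ∧ ∀ f : ℝ → ℝ, AntitoneOn f (Set.Ici 0) → f 0 ≤ M →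
      (∀ s, 0 ≤ s → κ * f s ^ (1 + γ) ≤ f s - f (s + T)) →
      ∀ t, 0 ≤ t → f t ≤ K / (1 + t) ^ (1 / γ) := by
  have hMγ : 0 < M ^ (-γ) := Real.rpow_pos_of_pos hM _
  -- Chosen so that θ(1 + (n+1)T) ≤ M^(-γ) + nγκ for every n.
  obtain ⟨θ, hθ, hθ1, hθ2⟩ : ∃ θ > 0, θ * (1 + T) ≤ M ^ (-γ) ∧ θ * T ≤ γ * κ := by
    refine ⟨min (M ^ (-γ) / (1 + T)) (γ * κ / T), by positivity, ?_, ?_⟩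
    · rw [← le_div_iff₀ (by positivity)]; exact min_le_left _ _
    · rw [← le_div_iff₀ hT]; exact min_le_right _ _
  refine ⟨θ ^ (-(1 / γ)), Real.rpow_pos_of_pos hθ _, fun f hf hfM hstep t ht => ?_⟩
  have h1t : 0 < 1 + t := by linarith
  rcases le_or_gt (f t) 0 with h0 | h0
  · exact h0.trans (by positivity)
  have hn : ∀ n : ℕ, n * T ≤ t → M ^ (-γ) + n * (γ * κ) ≤ f (n * T) ^ (-γ) := by
    intro n
    induction n with
    | zero =>
      intro _
      have hf0 : 0 < f 0 := h0.trans_le (hf Set.self_mem_Ici ht ht)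
      simpa using Real.rpow_le_rpow_of_nonpos hf0 hfM (by linarith)
    | succ n ih =>
      intro hnt
      push_cast at hnt ⊢
      have hnT : 0 ≤ n * T := by positivity
      have hnT' : (0 : ℝ) ≤ (n + 1) * T := by positivity
      have h2 : 0 < f ((n + 1) * T) := h0.trans_le (hf hnT' ht hnt)
      have h3 : 0 < f (n * T) := h2.trans_le (hf hnT hnT' (by linarith))
      have h4 := hstep (n * T) hnT
      rw [← add_one_mul (n : ℝ) T] at h4
      have h5 := rpow_neg_add_le_rpow_neg h3 h2 hγ h4
      linarith [ih (by linarith)]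
  set n := ⌊t / T⌋₊
  have hnt : n * T ≤ t := by
    rw [← le_div_iff₀ hT]; exact Nat.floor_le (by positivity)
  have hnt' : t < (n + 1) * T := by
    rw [← div_lt_iff₀ hT]; exact Nat.lt_floor_add_one _
  have h2 : f t ≤ f (n * T) := hf (Set.mem_Ici.2 (by positivity)) ht hnt
  have h3 : θ * (1 + t) ≤ f t ^ (-γ) := by
    have h4 : f (n * T) ^ (-γ) ≤ f t ^ (-γ) := Real.rpow_le_rpow_of_nonpos h0 h2 (by linarith)
    have h5 := hn n hnt
    have h6 : n * (θ * T) ≤ n * (γ * κ) := by gcongr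
    have h7 : θ * (1 + t) ≤ θ * (1 + (n + 1) * T) := by gcongr
    linarith
  have h4 := Real.rpow_le_rpow_of_nonpos (z := -(1 / γ)) (by positivity) h3
    (by have := one_div_pos.2 hγ; linarith)
  rw [← Real.rpow_mul h0.le, Real.mul_rpow hθ.le h1t.le,
    show -γ * -(1 / γ) = 1 by field_simp, Real.rpow_one, Real.rpow_neg h1t.le] at h4
  exact h4

/-- On [1, R] the continuous positive ρ has a positive minimum; hence κ depends on R, and later on
the energy bound. -/
theorem exists_mul_rpow_le {ρ : ℝ → ℝ} {γ c₀ : ℝ} (hρ : ContinuousOn ρ (Set.Ici 0))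
    (hρ_pos : ∀ s, 0 < s → 0 < ρ s) (hγ : 0 < γ) (hc₀ : 0 < c₀)
    (h : ∀ s ∈ Set.Icc (0 : ℝ) 1, c₀ * s ^ γ ≤ ρ s) (R : ℝ) :
    ∃ κ > 0, ∀ s ∈ Set.Icc 0 R, κ * s ^ γ ≤ ρ s := by
  rcases le_or_gt R 1 with hR | hR
  · exact ⟨c₀, hc₀, fun s hs => h s ⟨hs.1, hs.2.trans hR⟩⟩
  obtain ⟨x, hx, hmin⟩ := isCompact_Icc.exists_isMinOn (Set.nonempty_Icc.2 hR.le)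
    (hρ.mono fun s hs => Set.mem_Ici.2 (zero_le_one.trans hs.1))
  have hRγ : 0 < R ^ γ := Real.rpow_pos_of_pos (by linarith) _
  have hρx := hρ_pos x (by linarith [hx.1])
  refine ⟨min c₀ (ρ x / R ^ γ), by positivity, fun s hs => ?_⟩
  have hsγ : 0 ≤ s ^ γ := Real.rpow_nonneg hs.1 _
  rcases le_or_gt s 1 with hs1 | hs1
  · exact (mul_le_mul_of_nonneg_right (min_le_left _ _) hsγ).trans (h s ⟨hs.1, hs1⟩)
  · calc min c₀ (ρ x / R ^ γ) * s ^ γ ≤ ρ x / R ^ γ * R ^ γ := by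
          gcongr
          · exact min_le_right _ _
          · exact hs.2
      _ = ρ x := by field_simp
      _ ≤ ρ s := hmin ⟨hs1.le, hs.2⟩

/-- The step from a dissipation estimate with a free parameter `η` to a nonlinear difference
inequality for the energy. -/
theorem exists_mul_rpow_le_of_forall_pos {c T W L M γ : ℝ} (hc : 0 < c) (hT : 0 < T)
    (hW : 0 ≤ W) (hL : 0 ≤ L) (hγ : 0 < γ) :
    ∃ k > 0, ∀ e Δ : ℝ, 0 ≤ e → e ≤ M → 0 ≤ Δ →
      (∀ η > 0, c * e ≤ 2 * (η * T + η ^ (-γ) * W * Δ) + L * Δ) → k * e ^ (1 + γ) ≤ Δ := by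
  have hcT : 0 < c / (4 * T) := by positivity
  set D := 2 * (c / (4 * T)) ^ (-γ) * W + L * |M| ^ γ + 1 with hD
  have hD0 : 0 < D := by positivity
  refine ⟨c / 2 / D, by positivity, fun e Δ he heM hΔ h => ?_⟩
  rcases he.eq_or_lt with rfl | he
  · rw [Real.zero_rpow (by linarith)]; simpa using hΔ
  -- This η makes 2ηT = ce/2, half of the left side; multiplying the rest by e^γ cancels the factor
  -- e^(-γ) from η^(-γ).
  have h1 := h (c / (4 * T) * e) (by positivity)
  rw [Real.mul_rpow hcT.le he.le] at h1
  have h2 : e ^ (-γ) * e ^ γ = 1 := by rw [← Real.rpow_add he]; simp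
  have h3 : e ^ γ ≤ |M| ^ γ := Real.rpow_le_rpow he.le (heM.trans (le_abs_self M)) hγ.le
  have h4 : c / (4 * T) * e * T = c * e / 4 := by field_simp
  rw [h4] at h1
  have h5 : 0 < e ^ γ := Real.rpow_pos_of_pos he _
  have h6 : c * e / 2 ≤ 2 * ((c / (4 * T)) ^ (-γ) * e ^ (-γ) * W * Δ) + L * Δ := by linarith
  have h7 := mul_le_mul_of_nonneg_right h6 h5.le
  have h8 : L * Δ * e ^ γ ≤ L * Δ * |M| ^ γ := by gcongr
  rw [div_mul_eq_mul_div, div_le_iff₀ hD0, Real.rpow_add he, Real.rpow_one]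
  have h9 : 2 * ((c / (4 * T)) ^ (-γ) * e ^ (-γ) * W * Δ) * e ^ γ =
      2 * (c / (4 * T)) ^ (-γ) * W * Δ := by
    linear_combination (2 * (c / (4 * T)) ^ (-γ) * W * Δ) * h2
  rw [hD]
  linarith

/-- Either q ≤ η, or (q/η)^γ ≥ 1. -/
theorem le_add_rpow_mul {q η γ : ℝ} (hq : 0 ≤ q) (hη : 0 < η) (hγ : 0 < γ) :
    q ≤ η + η ^ (-γ) * (q ^ γ * q) := by
  have h0 : 0 < η ^ (-γ) := Real.rpow_pos_of_pos hη _
  have h1 : 0 ≤ q ^ γ := Real.rpow_nonneg hq _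
  rcases le_or_gt q η with h | h
  · have : 0 ≤ η ^ (-γ) * (q ^ γ * q) := by positivity
    linarith
  · have h2 : η ^ (-γ) * η ^ γ = 1 := by rw [← Real.rpow_add hη]; simp
    have h3 : η ^ γ ≤ q ^ γ := Real.rpow_le_rpow hη.le h.le hγ.le
    have h4 : η ^ (-γ) * (η ^ γ * q) ≤ η ^ (-γ) * (q ^ γ * q) := by gcongr
    rw [← mul_assoc, h2] at h4
    linarith

end DampedWave

/-! ### The decay theorem. -/

theorem mainTheorem8 {H : Type*} [NormedAddCommGroup H] [InnerProductSpace ℝ H] [CompleteSpace H]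
    (A : H →ₗ.[ℝ] H) (hA : DampedWave.IsPositiveCompactInverse A)
    (C : H →L[ℝ] H)
    (ρ : ℝ → ℝ) (hρ_cont : ContinuousOn ρ (Set.Ici 0))
    (hρ_nonneg : ∀ s, 0 ≤ s → 0 ≤ ρ s) (hρ_pos : ∀ s, 0 < s → 0 < ρ s)
    (γ c₀ c₁ : ℝ) (hγ : 0 < γ) (hc₀ : 0 < c₀) (hc₁ : 0 < c₁)
    (hρ : ∀ s ∈ Set.Icc (0 : ℝ) 1, c₀ * s ^ γ ≤ ρ s ∧ ρ s ≤ c₁ * s ^ γ)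
    (hobs : DampedWave.LinearlyObservable A C ∨ DampedWave.IntegrallyObservable A C ρ) :
    ∀ M : ℝ, ∃ K : ℝ, 0 < K ∧ ∀ u v : ℝ → H, DampedWave.IsWeakSolution A C ρ u v →
      DampedWave.energy A (u 0) (v 0) ≤ M →
      ∀ t : ℝ, 0 ≤ t → DampedWave.energy A (u t) (v t) ≤ K / (1 + t) ^ (1 / γ) := by
  intro M
  obtain ⟨ι, _, ⟨B⟩⟩ := hA.exists_eigenBasis
  -- The upper bound on ρ serves only here.
  have hρ0 : ρ 0 = 0 := by
    refine le_antisymm ?_ (hρ_nonneg 0 le_rfl)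
    simpa [Real.zero_rpow hγ.ne'] using (hρ 0 ⟨le_rfl, zero_le_one⟩).2
  obtain ⟨T, hT, c, hc, hB⟩ : ∃ T > 0, ∃ c > 0, B.ModeObservable C T c :=
    hobs.elim B.modeObservable_of_linearlyObservable
      (B.modeObservable_of_integrallyObservable hρ_cont hρ_nonneg hρ0)
  -- All values of ‖C u_t‖² lie in [0, R] when E(0) ≤ M, so κ and L below depend on the solution
  -- only through M.
  set R := ‖C‖ ^ 2 * (2 * |M|) with hR
  have hR0 : 0 ≤ R := by positivity
  obtain ⟨κ, hκ, hκρ⟩ := DampedWave.exists_mul_rpow_le hρ_cont hρ_pos hγ hc₀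
    (fun s hs => (hρ s hs).1) R
  obtain ⟨L, hL⟩ := isCompact_Icc.exists_bound_of_continuousOn
    (hρ_cont.mono (Set.Icc_subset_Ici_self : Set.Icc 0 R ⊆ _))
  have hL0 : 0 ≤ L := (norm_nonneg _).trans (hL 0 ⟨le_rfl, hR0⟩)
  obtain ⟨k, hk, hstep⟩ := DampedWave.exists_mul_rpow_le_of_forall_pos (M := M) hc hT
    (by positivity : 0 ≤ ‖C‖ ^ 2 / κ)
    (by positivity : 0 ≤ 2 * T * (‖C‖ ^ 2 * (Real.exp T * L))) hγ
  obtain ⟨K, hK, hdecay⟩ := DampedWave.exists_forall_le_div_one_add_rpow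
    (M := |M| + 1) (by positivity) hT hk hγ
  refine ⟨K, hK, fun u v huv hM => ?_⟩
  have hanti := huv.antitoneOn_energy hA hρ_nonneg
  refine hdecay _ hanti (hM.trans ((le_abs_self M).trans (by linarith))) fun s hs => ?_
  have hw := huv.shift hs
  have hEs : ∀ t, 0 ≤ t → DampedWave.energy A (u t) (v t) ≤ M := fun t ht =>
    (hanti Set.self_mem_Ici ht ht).trans hM
  have hmem : ∀ t, 0 ≤ t → ‖C (v t)‖ ^ 2 ∈ Set.Icc 0 R := by
    refine fun t ht => ⟨by positivity, ?_⟩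
    have h1 := DampedWave.norm_sq_le_energy A (u t) (v t)
    calc ‖C (v t)‖ ^ 2 ≤ (‖C‖ * ‖v t‖) ^ 2 := by gcongr; exact C.le_opNorm _
      _ = ‖C‖ ^ 2 * ‖v t‖ ^ 2 := by ring
      _ ≤ R := by
        rw [hR]
        gcongr
        linarith [hEs t ht, le_abs_self M]
  have h1 := hB.le_of_isWeakSolution hT.le hρ_nonneg hw hL0 fun t ht =>
    (le_abs_self _).trans (hL _ (hmem (s + t) (by positivity)))
  have h2 := hw.integral_dissipation_eq hA hρ_cont hT.le
  simp only [add_zero] at h1 h2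
  refine hstep _ _ (DampedWave.energy_nonneg _ _ _) (hEs s hs)
    (sub_nonneg.2 (hanti hs (Set.mem_Ici.2 (by positivity)) (by linarith))) fun η hη => ?_
  have hsub : Set.Icc (0 : ℝ) T ⊆ Set.Ici 0 := Set.Icc_subset_Ici_self
  have hcv : ContinuousOn (fun t => v (s + t)) (Set.Icc 0 T) := hw.continuousOn_velocity.mono hsub
  have hdis : IntervalIntegrable (fun t => ρ (‖C (v (s + t))‖ ^ 2) * ‖v (s + t)‖ ^ 2)
      MeasureTheory.volume 0 T :=
    (((hw.continuousOn_damping hρ_cont).mono hsub).mul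
      (hcv.norm.pow 2)).intervalIntegrable_of_Icc hT.le
  have h3 : ∫ t in (0 : ℝ)..T, ‖C (v (s + t))‖ ^ 2 ≤ ∫ t in (0 : ℝ)..T,
      (η + η ^ (-γ) * (‖C‖ ^ 2 / κ) * (ρ (‖C (v (s + t))‖ ^ 2) * ‖v (s + t)‖ ^ 2)) := by
    refine intervalIntegral.integral_mono_on hT.le
      (((C.continuous.comp_continuousOn hcv).norm.pow 2).intervalIntegrable_of_Icc hT.le)
      ((by simp : IntervalIntegrable (fun _ => η) MeasureTheory.volume 0 T).add
        (hdis.const_mul _)) fun t ht => ?_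
    have hst : 0 ≤ s + t := add_nonneg hs ht.1
    refine (DampedWave.le_add_rpow_mul (by positivity) hη hγ).trans ?_
    have h4 : (‖C (v (s + t))‖ ^ 2) ^ γ ≤ ρ (‖C (v (s + t))‖ ^ 2) / κ := by
      rw [le_div_iff₀ hκ, mul_comm]
      exact hκρ _ (hmem _ hst)
    have h5 : ‖C (v (s + t))‖ ^ 2 ≤ ‖C‖ ^ 2 * ‖v (s + t)‖ ^ 2 := by
      rw [← mul_pow]; gcongr; exact C.le_opNorm _
    have h6 : 0 ≤ ρ (‖C (v (s + t))‖ ^ 2) / κ :=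
      div_nonneg (hρ_nonneg _ (by positivity)) hκ.le
    have h7 := mul_le_mul h4 h5 (by positivity) h6
    calc η + η ^ (-γ) * ((‖C (v (s + t))‖ ^ 2) ^ γ * ‖C (v (s + t))‖ ^ 2)
        ≤ η + η ^ (-γ) * (ρ (‖C (v (s + t))‖ ^ 2) / κ * (‖C‖ ^ 2 * ‖v (s + t)‖ ^ 2)) := by
          gcongr
      _ = _ := by ring
  rw [intervalIntegral.integral_add (by simp) (hdis.const_mul _),
    intervalIntegral.integral_const_mul, intervalIntegral.integral_const, h2, sub_zero,
    smul_eq_mul] at h3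
  linarith
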